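/- **Theorem (eigenvector phase transition, rank-one additive perturbation).** For every $n\ge 1$ let $X_n$ and $P_n$ be independent $n\times n$ random matrices, all defined on one probability space, which are either real symmetric for all $n$ or complex Hermitian for all $n$. Assume that for each $n$ the law of $X_n$ or the law of $P_n$ is invariant under conjugation by every orthogonal matrix (real symmetric case), respectively by every unitary matrix (complex Hermitian case). Assume that: - almost surely, the empirical eigenvalue distribution $\mu_{X_n}=\frac1n\sum_{j=1}^n\delta_{\lambda_j(X_n)}$ converges weakly, as $n\to\infty$, to a non-random compactly supported probability measure $\mu_X$ on $\mathbb{R}$; - with $a$ and $b$ the infimum and the supremum of the support of $\mu_X$, the smallest and the largest eigenvalue of $X_n$ converge almost surely to $a$ and to $b$ respectively; - $P_n$ has rank $1$, and its only non-zero eigenvalue is a deterministic real number $\theta\neq 0$ that does not depend on $n$. Let $G_{\mu_X}(z)=\int\frac{1}{z-t}\,\mathrm{d}\mu_X(t)$ be the Cauchy transform of $\mu_X$, and write $f(c^+)=\lim_{z\downarrow c}f(z)$ and $f(c^-)=\lim_{z\uparrow c}f(z)$ for one-sided limits in $[-\infty,+\infty]$. Suppose that $$\frac1\theta\notin\bigl(G_{\mu_X}(a^-),\,G_{\mu_X}(b^+)\bigr)\quad\text{and}\quad\begin{cases}G_{\mu_X}'(b^+)=-\infty&\text{if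 }\theta>0,\\ G_{\mu_X}'(a^-)=-\infty&\text{if }\theta<0.\end{cases}$$ For each $n$ let $\widetilde u_n$ be a unit-norm eigenvector of $X_n+P_n$ associated with its largest eigenvalue if $\theta>0$, and with its smallest eigenvalue if $\theta<0$. Then, almost surely, the norm of the orthogonal projection of $\widetilde u_n$ onto $\ker(\theta I_n-P_n)$ tends to $0$ as $n\to\infty$. -/

import Mathlib

open MeasureTheory ProbabilityTheory Filter Topology

noncomputable section

namespace SpikedModel

/-- The largest eigenvalue of a Hermitian matrix. -/
def largestEigenvalue {𝕜 : Type*} [RCLike 𝕜] {ι : Type*} [Fintype ι] [DecidableEq ι] [Nonempty ι]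
    {A : Matrix ι ι 𝕜} (hA : A.IsHermitian) : ℝ :=
  Finset.univ.sup' Finset.univ_nonempty hA.eigenvalues

/-- The smallest eigenvalue of a Hermitian matrix. -/
def smallestEigenvalue {𝕜 : Type*} [RCLike 𝕜] {ι : Type*} [Fintype ι] [DecidableEq ι] [Nonempty ι]
    {A : Matrix ι ι 𝕜} (hA : A.IsHermitian) : ℝ :=
  Finset.univ.inf' Finset.univ_nonempty hA.eigenvalues

/-- The empirical eigenvalue distribution of a Hermitian matrix: each eigenvalue, counted with
multiplicity, carries mass one over the size of the matrix. -/
def empiricalSpectralMeasure {𝕜 : Type*} [RCLike 𝕜] {ι : Type*} [Fintype ι] [DecidableEq ι]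
    [Nonempty ι] {A : Matrix ι ι 𝕜} (hA : A.IsHermitian) : ProbabilityMeasure ℝ :=
  ⟨(Fintype.card ι : ENNReal)⁻¹ • ∑ i, Measure.dirac (hA.eigenvalues i), ⟨by
    simp only [Measure.smul_apply, Measure.coe_finsetSum, Finset.sum_apply, measure_univ,
      Finset.sum_const, Finset.card_univ, nsmul_eq_mul, mul_one, smul_eq_mul]
    exact ENNReal.inv_mul_cancel (by simp) (by simp)⟩⟩

/-- The Cauchy transform `z ↦ ∫ 1 / (z - t) dμ(t)` on the real axis (used off the support of `μ`). -/
def cauchyTransform (μ : Measure ℝ) (z : ℝ) : ℝ := ∫ t, 1 / (z - t) ∂μ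

/-- Matrices carry the entrywise (product) measurable structure. -/
instance instMeasurableSpaceMatrix {ι κ R : Type*} [MeasurableSpace R] :
    MeasurableSpace (Matrix ι κ R) :=
  MeasurableSpace.pi

/-- The law of the random matrix `A` is invariant under conjugation by the unitary group of `𝕜`:
orthogonal invariance if `𝕜 = ℝ`, unitary invariance if `𝕜 = ℂ`. -/
def IsConjInvariant {𝕜 : Type*} [RCLike 𝕜] {ι : Type*} [Fintype ι] [DecidableEq ι]
    {Ω : Type*} [MeasurableSpace Ω] (Pr : Measure Ω) (A : Ω → Matrix ι ι 𝕜) : Prop :=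
  ∀ U ∈ Matrix.unitaryGroup ι 𝕜, Pr.map (fun ω => U * A ω * star U) = Pr.map A

/-- The eigenspace `ker (θ I - A)` as a subspace of Euclidean space. -/
def kerSub {𝕜 : Type*} [RCLike 𝕜] {ι : Type*} [Fintype ι] [DecidableEq ι]
    (θ : ℝ) (A : Matrix ι ι 𝕜) : Submodule 𝕜 (EuclideanSpace 𝕜 ι) :=
  LinearMap.ker (Matrix.toEuclideanLin ((θ : 𝕜) • (1 : Matrix ι ι 𝕜) - A))

/-- `⟨x, F⟩`: the norm of the orthogonal projection of `x` onto the subspace `F`. -/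
def projNorm {𝕜 : Type*} [RCLike 𝕜] {ι : Type*} [Fintype ι]
    (x : EuclideanSpace 𝕜 ι) (F : Submodule 𝕜 (EuclideanSpace 𝕜 ι)) : ℝ :=
  ‖F.orthogonalProjectionOnto x‖

/-- `x` is a unit-norm eigenvector of `A` for the real eigenvalue `l`. -/
def IsUnitEigenvector {𝕜 : Type*} [RCLike 𝕜] {ι : Type*} [Fintype ι] [DecidableEq ι]
    (A : Matrix ι ι 𝕜) (l : ℝ) (x : EuclideanSpace 𝕜 ι) : Prop :=
  ‖x‖ = 1 ∧ Matrix.toEuclideanLin A x = (l : 𝕜) • x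

end SpikedModel

end

noncomputable section

namespace SpikedModel

open Matrix

/-! Write `P = θ v v*` with `v` a unit vector and take coordinates in an eigenbasis of `X` with
eigenvalues `l i`. Let `p i`, `q i` be the moduli of the coordinates of `v` and of the leading
eigenvector `u`, let `t = |⟨v, u⟩|`, and let `L` be the extreme eigenvalue of `X + P`. For `θ > 0`
the eigenvector equation reads `θ t p i = (L - l i) q i`.

Conjugation invariance makes `v` as good as Haar distributed relative to the eigenbasis of `X`, so
the weights `p i ^ 2` average test functions of the eigenvalues as uniform weights do. Indeed a
centred linear form in the squared coordinates of a Haar vector has fourth moment `O(n⁻²)`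
(`integral_centered_form_pow_four_le`), which is summable, so all moments match almost surely
(`ae_tendsto_momentGap`). Hence `∑ p i ^ 2 / (z - l i) ^ m` tends to `∫ 1 / (z - t) ^ m dμ` for each
`z > b`.

The rest is deterministic (`tendsto_overlap_zero`). Subcriticality gives `θ G(z) < 1` for all `z >
b`, which forces `L < z` eventually. Then `1 = ∑ q i ^ 2 ≥ θ² t² ∑ p i ^ 2 / (z - l i) ^ 2`, and the
last sum is close to `∫ 1 / (z - t) ^ 2 dμ`, which is arbitrarily large for `z` near `b` because
`G'(b⁺) = -∞`. So `t` tends to `0`. Negation reduces `θ < 0` to this case. -/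

instance instBorelSpaceMatrix {ι κ R : Type*} [Countable ι] [Countable κ] [TopologicalSpace R]
    [MeasurableSpace R] [SecondCountableTopology R] [BorelSpace R] : BorelSpace (Matrix ι κ R) :=
  inferInstanceAs (BorelSpace (ι → κ → R))

instance instSecondCountableMatrix {ι κ R : Type*} [Countable ι] [Countable κ] [TopologicalSpace R]
    [SecondCountableTopology R] : SecondCountableTopology (Matrix ι κ R) :=
  inferInstanceAs (SecondCountableTopology (ι → κ → R))

/-! ### Haar measure on the unitary group and two explicit unitaries. -/

section unitary
variable {𝕜 : Type*} [RCLike 𝕜] {ι : Type*} [Fintype ι] [DecidableEq ι]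

/-- Compactness normalizes Haar measure to mass one and makes every continuous function integrable.
-/
instance instCompactSpaceUnitaryGroup : CompactSpace (Matrix.unitaryGroup ι 𝕜) := by
  apply isCompact_iff_compactSpace.mp
  have hK : IsCompact (Set.univ.pi fun _ : ι => Set.univ.pi fun _ : ι =>
      Metric.closedBall (0 : 𝕜) 1) :=
    isCompact_univ_pi fun _ => isCompact_univ_pi fun _ => isCompact_closedBall _ _
  refine IsCompact.of_isClosed_subset hK ?_ ?_
  · have : ((Matrix.unitaryGroup ι 𝕜 : Submonoid (Matrix ι ι 𝕜)) : Set (Matrix ι ι 𝕜)) =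
        {A | star A * A = 1} := by
      ext A; exact Matrix.mem_unitaryGroup_iff'
    rw [this]
    exact isClosed_eq (by fun_prop) continuous_const
  · intro A hA
    exact fun i _ j _ => mem_closedBall_zero_iff.2 (entry_norm_bound_of_unitary hA i j)

/-- The normalized Haar measure of the unitary group. -/
def unitaryHaar (ι 𝕜 : Type*) [RCLike 𝕜] [Fintype ι] [DecidableEq ι] :
    Measure (Matrix.unitaryGroup ι 𝕜) :=
  Measure.haarMeasure ⊤

instance instIsProbabilityMeasureUnitaryHaar : IsProbabilityMeasure (unitaryHaar ι 𝕜) := ⟨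
  Measure.haarMeasure_self (K₀ := (⊤ : TopologicalSpace.PositiveCompacts (unitaryGroup ι 𝕜)))⟩

instance instIsMulLeftInvariantUnitaryHaar : (unitaryHaar ι 𝕜).IsMulLeftInvariant :=
  inferInstanceAs (Measure.haarMeasure _).IsMulLeftInvariant

/-- All moment estimates draw on left invariance only through this identity, applied to coordinate
permutations, to 45° rotations of a coordinate plane and to the eigenvector matrix. -/
theorem integral_unitaryHaar_mulVec (φ : (ι → 𝕜) → ℝ) (V : Matrix.unitaryGroup ι 𝕜) (v : ι → 𝕜) :
    ∫ U, φ (V.1 *ᵥ (U.1 *ᵥ v)) ∂(unitaryHaar ι 𝕜) = ∫ U, φ (U.1 *ᵥ v) ∂(unitaryHaar ι 𝕜) := by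
  rw [← integral_mul_left_eq_self (fun U : unitaryGroup ι 𝕜 => φ (U.1 *ᵥ v)) V]
  simp [Matrix.mulVec_mulVec]

theorem integrable_unitaryHaar_mulVec {φ : (ι → 𝕜) → ℝ} (hφ : Continuous φ) (v : ι → 𝕜) :
    Integrable (fun U => φ (U.1 *ᵥ v)) (unitaryHaar ι 𝕜) := by
  have : Continuous (fun U : Matrix.unitaryGroup ι 𝕜 => φ (U.1 *ᵥ v)) := by fun_prop
  exact this.integrable_of_hasCompactSupport (HasCompactSupport.of_compactSpace _)

/-- The matrix of the coordinate permutation `σ`, as a unitary matrix. -/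
def permUnitary (𝕜 : Type*) [RCLike 𝕜] (σ : Equiv.Perm ι) : Matrix.unitaryGroup ι 𝕜 :=
  ⟨σ.permMatrix 𝕜, by
    rw [Matrix.mem_unitaryGroup_iff, Matrix.star_eq_conjTranspose, Matrix.conjTranspose_permMatrix,
      ← Matrix.permMatrix_mul]
    simp⟩

theorem permUnitary_mulVec (σ : Equiv.Perm ι) (x : ι → 𝕜) :
    (permUnitary 𝕜 σ).1 *ᵥ x = x ∘ σ := by
  exact Matrix.permMatrix_mulVec _

theorem planeHadamard_matrix_mem_unitaryGroup {i j : ι} (hij : i ≠ j) (c : 𝕜)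
    (hc : c * c = 1 / 2) (hs : star c = c) :
    (1 + (c - 1) • Matrix.single i i 1 - (c + 1) • Matrix.single j j 1 + c • Matrix.single i j 1 +
      c • Matrix.single j i 1 : Matrix ι ι 𝕜) ∈ Matrix.unitaryGroup ι 𝕜 := by
  rw [Matrix.mem_unitaryGroup_iff]
  simp only [star_add, star_sub, star_smul, star_one, hs]
  simp only [Matrix.star_eq_conjTranspose, Matrix.conjTranspose_single, star_one]
  simp only [add_mul, sub_mul, mul_add, mul_sub, one_mul, mul_one, smul_mul_assoc, mul_smul_comm,
    Matrix.single_mul_single_same, Matrix.single_mul_single_of_ne _ _ _ _ hij,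
    Matrix.single_mul_single_of_ne _ _ _ _ hij.symm]
  match_scalars
  · ring
  · linear_combination 2 * hc
  · linear_combination 2 * hc
  · ring
  · ring

/-- The unitary matrix that maps `x` to `((xᵢ + xⱼ) / √2, (xᵢ - xⱼ) / √2)` in the coordinates
`i`, `j` and fixes the other coordinates. -/
def planeHadamard (𝕜 : Type*) [RCLike 𝕜] {i j : ι} (hij : i ≠ j) : Matrix.unitaryGroup ι 𝕜 :=
  ⟨_, planeHadamard_matrix_mem_unitaryGroup (𝕜 := 𝕜) hij ((√(1 / 2) : ℝ) : 𝕜) (by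
    rw [← RCLike.ofReal_mul, Real.mul_self_sqrt (by norm_num)]; push_cast; rfl) (by simp)⟩

theorem norm_planeHadamard_mulVec_left {i j : ι} (hij : i ≠ j) (x : ι → 𝕜) :
    ‖((planeHadamard 𝕜 hij).1 *ᵥ x) i‖ ^ 2 = ‖x i + x j‖ ^ 2 / 2 := by
  have : ((planeHadamard 𝕜 hij).1 *ᵥ x) i = ((√(1 / 2) : ℝ) : 𝕜) * (x i + x j) := by
    simp [planeHadamard, Matrix.add_mulVec, Matrix.sub_mulVec, Matrix.single_mulVec, hij,
      Function.update]
    ring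
  rw [this, norm_mul, mul_pow]
  simp
  ring

theorem norm_planeHadamard_mulVec_right {i j : ι} (hij : i ≠ j) (x : ι → 𝕜) :
    ‖((planeHadamard 𝕜 hij).1 *ᵥ x) j‖ ^ 2 = ‖x i - x j‖ ^ 2 / 2 := by
  have : ((planeHadamard 𝕜 hij).1 *ᵥ x) j = ((√(1 / 2) : ℝ) : 𝕜) * (x i - x j) := by
    simp [planeHadamard, Matrix.add_mulVec, Matrix.sub_mulVec, Matrix.single_mulVec, hij.symm,
      Function.update]
    ring
  rw [this, norm_mul, mul_pow]
  simp
  ring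

end unitary

/-! ### Moments of one coordinate of a Haar-random unit vector. -/

section moments
variable {𝕜 : Type*} [RCLike 𝕜] {ι : Type*} [Fintype ι] [DecidableEq ι]

theorem sum_norm_sq_unitary_mulVec (U : unitaryGroup ι 𝕜) (v : ι → 𝕜) :
    ∑ i, ‖(U.1 *ᵥ v) i‖ ^ 2 = ∑ i, ‖v i‖ ^ 2 := by
  have key : ∀ x : ι → 𝕜, ((∑ i, ‖x i‖ ^ 2 : ℝ) : 𝕜) = star x ⬝ᵥ x := by
    intro x
    simp [dotProduct, RCLike.conj_mul]
  apply RCLike.ofReal_injective (K := 𝕜)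
  rw [key, key, Matrix.star_mulVec, Matrix.dotProduct_mulVec, Matrix.vecMul_vecMul,
    ← Matrix.star_eq_conjTranspose, Matrix.mem_unitaryGroup_iff'.1 U.2, Matrix.vecMul_one]

theorem integral_unitaryHaar_swap (φ : (ι → 𝕜) → ℝ) (σ : Equiv.Perm ι) (v : ι → 𝕜) :
    ∫ U, φ ((U.1 *ᵥ v) ∘ σ) ∂(unitaryHaar ι 𝕜) = ∫ U, φ (U.1 *ᵥ v) ∂(unitaryHaar ι 𝕜) := by
  rw [← integral_unitaryHaar_mulVec φ (permUnitary 𝕜 σ) v]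
  simp only [permUnitary_mulVec]

theorem integral_coord_eq (f : 𝕜 → 𝕜 → ℝ) (i j : ι) (v : ι → 𝕜) :
    ∫ U, f ((U.1 *ᵥ v) j) ((U.1 *ᵥ v) i) ∂(unitaryHaar ι 𝕜) =
      ∫ U, f ((U.1 *ᵥ v) i) ((U.1 *ᵥ v) j) ∂(unitaryHaar ι 𝕜) := by
  rw [← integral_unitaryHaar_swap (fun x => f (x i) (x j)) (Equiv.swap i j) v]
  simp

theorem integral_coord_sq {v : ι → 𝕜} (hv : ∑ i, ‖v i‖ ^ 2 = 1) (i : ι) :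
    (Fintype.card ι : ℝ) * ∫ U, ‖(U.1 *ᵥ v) i‖ ^ 2 ∂(unitaryHaar ι 𝕜) = 1 := by
  have h : ∀ j, ∫ U, ‖(U.1 *ᵥ v) j‖ ^ 2 ∂(unitaryHaar ι 𝕜) =
      ∫ U, ‖(U.1 *ᵥ v) i‖ ^ 2 ∂(unitaryHaar ι 𝕜) := fun j =>
    integral_coord_eq (fun a _ => ‖a‖ ^ 2) i j v
  have h2 : ∑ j, ∫ U, ‖(U.1 *ᵥ v) j‖ ^ 2 ∂(unitaryHaar ι 𝕜) = 1 := by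
    rw [← integral_finsetSum]
    · simp [sum_norm_sq_unitary_mulVec, hv]
    · exact fun j _ => integrable_unitaryHaar_mulVec (φ := fun x => ‖x j‖ ^ 2) (by fun_prop) v
  simpa [h] using h2

/-- Let `m` be the moment of order `k + 1` and `x` the mixed moment of coordinates `i`, `j`.
Rotating that plane by 45° preserves `m`, so integrating `h` gives `2m ≤ 2αm + 2(1 - α)cx`, that is
`m ≤ c x`. Summing over `j ≠ i` and using that the squared coordinates sum to one yields the
recursion. -/
theorem integral_coord_pow_succ_le {v : ι → 𝕜} (hv : ∑ i, ‖v i‖ ^ 2 = 1) (i : ι) (k : ℕ)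
    {α c : ℝ} (hα : α < 1) (hc : 0 ≤ c)
    (h : ∀ a b : 𝕜, (‖a + b‖ ^ 2 / 2) ^ (k + 1) + (‖a - b‖ ^ 2 / 2) ^ (k + 1) ≤
      α * ((‖a‖ ^ 2) ^ (k + 1) + (‖b‖ ^ 2) ^ (k + 1)) +
        (1 - α) * c * ((‖a‖ ^ 2) ^ k * ‖b‖ ^ 2 + (‖b‖ ^ 2) ^ k * ‖a‖ ^ 2)) :
    ((Fintype.card ι : ℝ) - 1) * ∫ U, (‖(U.1 *ᵥ v) i‖ ^ 2) ^ (k + 1) ∂(unitaryHaar ι 𝕜) ≤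
      c * ∫ U, (‖(U.1 *ᵥ v) i‖ ^ 2) ^ k ∂(unitaryHaar ι 𝕜) := by
  set m := ∫ U, (‖(U.1 *ᵥ v) i‖ ^ 2) ^ (k + 1) ∂(unitaryHaar ι 𝕜) with hm
  have step : ∀ j, j ≠ i →
      m ≤ c * ∫ U, (‖(U.1 *ᵥ v) i‖ ^ 2) ^ k * ‖(U.1 *ᵥ v) j‖ ^ 2 ∂(unitaryHaar ι 𝕜) := by
    intro j hj
    set x := ∫ U, (‖(U.1 *ᵥ v) i‖ ^ 2) ^ k * ‖(U.1 *ᵥ v) j‖ ^ 2 ∂(unitaryHaar ι 𝕜) with hx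
    have hx' : ∫ U, (‖(U.1 *ᵥ v) j‖ ^ 2) ^ k * ‖(U.1 *ᵥ v) i‖ ^ 2 ∂(unitaryHaar ι 𝕜) = x :=
      integral_coord_eq (fun a b => (‖a‖ ^ 2) ^ k * ‖b‖ ^ 2) i j v
    have hm' : ∫ U, (‖(U.1 *ᵥ v) j‖ ^ 2) ^ (k + 1) ∂(unitaryHaar ι 𝕜) = m :=
      integral_coord_eq (fun a _ => (‖a‖ ^ 2) ^ (k + 1)) i j v
    have h1 := integral_unitaryHaar_mulVec (fun x : ι → 𝕜 => (‖x i‖ ^ 2) ^ (k + 1))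
      (planeHadamard 𝕜 hj.symm) v
    have h2 := integral_unitaryHaar_mulVec (fun x : ι → 𝕜 => (‖x j‖ ^ 2) ^ (k + 1))
      (planeHadamard 𝕜 hj.symm) v
    simp only [norm_planeHadamard_mulVec_left, norm_planeHadamard_mulVec_right] at h1 h2
    rw [hm'] at h2
    have i1 := integrable_unitaryHaar_mulVec (𝕜 := 𝕜)
      (φ := fun x => (‖x i + x j‖ ^ 2 / 2) ^ (k + 1)) (by fun_prop) v
    have i2 := integrable_unitaryHaar_mulVec (𝕜 := 𝕜)
      (φ := fun x => (‖x i - x j‖ ^ 2 / 2) ^ (k + 1)) (by fun_prop) v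
    have i3 := integrable_unitaryHaar_mulVec (𝕜 := 𝕜)
      (φ := fun x => (‖x i‖ ^ 2) ^ (k + 1)) (by fun_prop) v
    have i4 := integrable_unitaryHaar_mulVec (𝕜 := 𝕜)
      (φ := fun x => (‖x j‖ ^ 2) ^ (k + 1)) (by fun_prop) v
    have i5 := integrable_unitaryHaar_mulVec (𝕜 := 𝕜)
      (φ := fun x => (‖x i‖ ^ 2) ^ k * ‖x j‖ ^ 2) (by fun_prop) v
    have i6 := integrable_unitaryHaar_mulVec (𝕜 := 𝕜)
      (φ := fun x => (‖x j‖ ^ 2) ^ k * ‖x i‖ ^ 2) (by fun_prop) v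
    have key := integral_mono (i1.add i2)
      (((i3.add i4).const_mul α).add ((i5.add i6).const_mul ((1 - α) * c)))
      (fun U => h ((U.1 *ᵥ v) i) ((U.1 *ᵥ v) j))
    rw [integral_add' i1 i2, integral_add' ((i3.add i4).const_mul α)
      ((i5.add i6).const_mul ((1 - α) * c)), integral_const_mul, integral_const_mul,
      integral_add' i3 i4, integral_add' i5 i6, h1, h2, hx', hm', ← hm, ← hx] at key
    have : 0 < 1 - α := by linarith
    nlinarith
  have hsum : ∑ j ∈ Finset.univ.erase i, m ≤ ∑ j ∈ Finset.univ.erase i,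
      c * ∫ U, (‖(U.1 *ᵥ v) i‖ ^ 2) ^ k * ‖(U.1 *ᵥ v) j‖ ^ 2 ∂(unitaryHaar ι 𝕜) :=
    Finset.sum_le_sum fun j hj => step j (Finset.ne_of_mem_erase hj)
  have hcard : ((Finset.univ.erase i).card : ℝ) = (Fintype.card ι : ℝ) - 1 := by
    rw [Finset.card_erase_of_mem (Finset.mem_univ i), Finset.card_univ,
      Nat.cast_sub (Fintype.card_pos_iff.2 ⟨i⟩), Nat.cast_one]
  rw [Finset.sum_const, nsmul_eq_mul, hcard, ← Finset.mul_sum, ← integral_finsetSum] at hsum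
  · refine hsum.trans (mul_le_mul_of_nonneg_left ?_ hc)
    refine integral_mono
      (integrable_unitaryHaar_mulVec (𝕜 := 𝕜)
        (φ := fun x => ∑ j ∈ Finset.univ.erase i, (‖x i‖ ^ 2) ^ k * ‖x j‖ ^ 2) (by fun_prop) v)
      (integrable_unitaryHaar_mulVec (𝕜 := 𝕜)
        (φ := fun x => (‖x i‖ ^ 2) ^ k) (by fun_prop) v) fun U => ?_
    simp only
    rw [← Finset.mul_sum]
    refine mul_le_of_le_one_right (by positivity) ?_
    rw [← hv, ← sum_norm_sq_unitary_mulVec U v]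
    exact Finset.sum_le_sum_of_subset_of_nonneg (Finset.erase_subset _ _) fun _ _ _ => by positivity
  · exact fun j _ => integrable_unitaryHaar_mulVec (𝕜 := 𝕜)
      (φ := fun x => (‖x i‖ ^ 2) ^ k * ‖x j‖ ^ 2) (by fun_prop) v

/-- With `r` the real part of the inner product, Cauchy–Schwarz handles the real and complex fields
alike and reduces the hypothesis `h` above to a polynomial inequality in `‖a‖ ^ 2`, `‖b‖ ^ 2` and
`r`. -/
theorem exists_norm_add_sub_sq (a b : 𝕜) : ∃ r : ℝ, r ^ 2 ≤ ‖a‖ ^ 2 * ‖b‖ ^ 2 ∧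
    ‖a + b‖ ^ 2 = ‖a‖ ^ 2 + ‖b‖ ^ 2 + 2 * r ∧ ‖a - b‖ ^ 2 = ‖a‖ ^ 2 + ‖b‖ ^ 2 - 2 * r := by
  refine ⟨RCLike.re (inner 𝕜 a b), ?_, ?_, ?_⟩
  · rw [← mul_pow]
    exact sq_le_sq' (by
      have := (abs_le.1 ((RCLike.abs_re_le_norm _).trans (norm_inner_le_norm (𝕜 := 𝕜) a b))).1
      exact this) ((RCLike.re_le_norm _).trans (norm_inner_le_norm (𝕜 := 𝕜) a b))
  · rw [@norm_add_sq 𝕜]; ring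
  · rw [@norm_sub_sq 𝕜]; ring

theorem card_pow_mul_integral_coord_pow_four_le {v : ι → 𝕜} (hv : ∑ i, ‖v i‖ ^ 2 = 1)
    (hn : 2 ≤ Fintype.card ι) (i : ι) :
    (Fintype.card ι : ℝ) ^ 4 * ∫ U, (‖(U.1 *ᵥ v) i‖ ^ 2) ^ 4 ∂(unitaryHaar ι 𝕜) ≤ 1080 := by
  have h1 := integral_coord_sq hv i
  -- In the three recursions `α = 2⁻ᵏ` is the coefficient of the pure powers after expansion; `c`
  -- comes from replacing `r ^ 2` by its bound `‖a‖ ^ 2 * ‖b‖ ^ 2`.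
  have h2 := integral_coord_pow_succ_le hv i 1 (α := 1 / 2) (c := 3) (by norm_num) (by norm_num) (by
    intro a b
    obtain ⟨r, hr, e1, e2⟩ := exists_norm_add_sub_sq a b
    rw [e1, e2]
    nlinarith)
  have h3 := integral_coord_pow_succ_le hv i 2 (α := 1 / 4) (c := 5) (by norm_num) (by norm_num) (by
    intro a b
    obtain ⟨r, hr, e1, e2⟩ := exists_norm_add_sub_sq a b
    rw [e1, e2]
    have hA : 0 ≤ ‖a‖ ^ 2 := by positivity
    have hB : 0 ≤ ‖b‖ ^ 2 := by positivity
    generalize ‖a‖ ^ 2 = A at *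
    generalize ‖b‖ ^ 2 = B at *
    nlinarith [mul_nonneg (add_nonneg hA hB) (sub_nonneg.2 hr)])
  have h4 := integral_coord_pow_succ_le hv i 3 (α := 1 / 8) (c := 9) (by norm_num) (by norm_num) (by
    intro a b
    obtain ⟨r, hr, e1, e2⟩ := exists_norm_add_sub_sq a b
    rw [e1, e2]
    have hA : 0 ≤ ‖a‖ ^ 2 := by positivity
    have hB : 0 ≤ ‖b‖ ^ 2 := by positivity
    generalize ‖a‖ ^ 2 = A at *
    generalize ‖b‖ ^ 2 = B at *
    have hAB := mul_nonneg hA hB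
    have hr4 : (r ^ 2) ^ 2 ≤ (A * B) ^ 2 := pow_le_pow_left₀ (sq_nonneg r) hr 2
    nlinarith [mul_nonneg (sq_nonneg (A + B)) (sub_nonneg.2 hr), mul_nonneg hAB (sq_nonneg (A - B))])
  simp only [pow_one, Nat.reduceAdd] at h1 h2 h3 h4
  have hn' : (2 : ℝ) ≤ Fintype.card ι := by exact_mod_cast hn
  generalize (Fintype.card ι : ℝ) = n at *
  have p4 : 0 ≤ ∫ U, (‖(U.1 *ᵥ v) i‖ ^ 2) ^ 4 ∂(unitaryHaar ι 𝕜) :=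
    integral_nonneg fun U => by positivity
  generalize ∫ U, (‖(U.1 *ᵥ v) i‖ ^ 2) ^ 4 ∂(unitaryHaar ι 𝕜) = m4 at *
  generalize ∫ U, (‖(U.1 *ᵥ v) i‖ ^ 2) ^ 3 ∂(unitaryHaar ι 𝕜) = m3 at *
  generalize ∫ U, (‖(U.1 *ᵥ v) i‖ ^ 2) ^ 2 ∂(unitaryHaar ι 𝕜) = m2 at *
  generalize ∫ U, ‖(U.1 *ᵥ v) i‖ ^ 2 ∂(unitaryHaar ι 𝕜) = m1 at *
  have hn1 : 0 ≤ n - 1 := by linarith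
  -- Since `n ≤ 2 (n - 1)`, the constant is `2 ^ 3 * 9 * 5 * 3 = 1080`.
  calc n ^ 4 * m4 ≤ n * (2 * (n - 1)) ^ 3 * m4 := by
        have : n ^ 3 ≤ (2 * (n - 1)) ^ 3 := pow_le_pow_left₀ (by linarith) (by linarith) 3
        have h5 := mul_le_mul_of_nonneg_right this (by positivity : 0 ≤ n * m4)
        linarith
    _ = 8 * n * (n - 1) ^ 2 * ((n - 1) * m4) := by ring
    _ ≤ 8 * n * (n - 1) ^ 2 * (9 * m3) := by gcongr
    _ = 72 * n * (n - 1) * ((n - 1) * m3) := by ring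
    _ ≤ 72 * n * (n - 1) * (5 * m2) := by gcongr
    _ = 360 * n * ((n - 1) * m2) := by ring
    _ ≤ 360 * n * (3 * m1) := by gcongr
    _ = 1080 := by linear_combination 1080 * h1

end moments

/-! ### Fourth moment of linear forms in the squared coordinates. -/

section fourthMoment
variable {𝕜 : Type*} [RCLike 𝕜] {ι : Type*}

/-- The coordinate difference `|xᵢ|² - |x_τᵢ|²`. -/
def coordDiff (τ : Equiv.Perm ι) (i : ι) (x : ι → 𝕜) : ℝ := ‖x i‖ ^ 2 - ‖x (τ i)‖ ^ 2

theorem continuous_coordDiff (τ : Equiv.Perm ι) (i : ι) :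
    Continuous (coordDiff (𝕜 := 𝕜) τ i) := by
  unfold coordDiff; fun_prop

theorem sum_pow_four_expand {R : Type*} [CommSemiring R] [Fintype ι] (g : ι → R) :
    (∑ i, g i) ^ 4 = ∑ i, ∑ j, ∑ l, ∑ m, g i * g j * g l * g m := by
  simp only [← Finset.mul_sum, ← Finset.sum_mul]
  ring

variable [DecidableEq ι]

theorem coordDiff_swap_self {τ : Equiv.Perm ι} (i : ι) (x : ι → 𝕜) :
    coordDiff τ i (x ∘ Equiv.swap i (τ i)) = - coordDiff τ i x := by
  simp [coordDiff]

theorem coordDiff_swap_of_ne {τ : Equiv.Perm ι} (hτ : ∀ i, τ (τ i) = i) {i j : ι} (h1 : j ≠ i)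
    (h2 : j ≠ τ i) (x : ι → 𝕜) :
    coordDiff τ j (x ∘ Equiv.swap i (τ i)) = coordDiff τ j x := by
  have h3 : τ j ≠ i := fun h => h2 (by rw [← h, hτ])
  have h4 : τ j ≠ τ i := fun h => h1 (τ.injective h)
  simp [coordDiff, Equiv.swap_apply_of_ne_of_ne, h1, h2, h3, h4]

variable [Fintype ι]

/-- Swapping the coordinates `i` and `τ i` flips the sign of the first factor and fixes the others,
so the integral equals its negative. The differences thus behave like variables with independent
symmetric signs. -/
theorem integral_coordDiff_mul_eq_zero {τ : Equiv.Perm ι} (hτ : ∀ i, τ (τ i) = i) {i j l m : ι}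
    (hj : j ≠ i ∧ j ≠ τ i) (hl : l ≠ i ∧ l ≠ τ i) (hm : m ≠ i ∧ m ≠ τ i) (v : ι → 𝕜) :
    ∫ U, coordDiff τ i (U.1 *ᵥ v) * coordDiff τ j (U.1 *ᵥ v) * coordDiff τ l (U.1 *ᵥ v) *
      coordDiff τ m (U.1 *ᵥ v) ∂(unitaryHaar ι 𝕜) = 0 := by
  have h := integral_unitaryHaar_swap (fun x : ι → 𝕜 => coordDiff τ i x * coordDiff τ j x *
    coordDiff τ l x * coordDiff τ m x) (Equiv.swap i (τ i)) v
  simp only [coordDiff_swap_self, coordDiff_swap_of_ne hτ hj.1 hj.2,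
    coordDiff_swap_of_ne hτ hl.1 hl.2, coordDiff_swap_of_ne hτ hm.1 hm.2, neg_mul,
    integral_neg] at h
  linarith

/-- By the arithmetic–geometric mean inequality the product is at most the mean of the four fourth
powers, and `(A - B) ^ 4 ≤ A ^ 4 + B ^ 4` for nonnegative `A`, `B`. -/
theorem abs_integral_coordDiff_mul_le {v : ι → 𝕜} {M : ℝ}
    (hM : ∀ i, ∫ U, (‖(U.1 *ᵥ v) i‖ ^ 2) ^ 4 ∂(unitaryHaar ι 𝕜) ≤ M)
    (τ : Equiv.Perm ι) (i j l m : ι) :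
    |∫ U, coordDiff τ i (U.1 *ᵥ v) * coordDiff τ j (U.1 *ᵥ v) * coordDiff τ l (U.1 *ᵥ v) *
      coordDiff τ m (U.1 *ᵥ v) ∂(unitaryHaar ι 𝕜)| ≤ 2 * M := by
  have c := continuous_coordDiff (𝕜 := 𝕜) τ
  have four : ∀ i, ∫ U, coordDiff τ i (U.1 *ᵥ v) ^ 4 ∂(unitaryHaar ι 𝕜) ≤ 2 * M := by
    intro i
    have i1 := integrable_unitaryHaar_mulVec (𝕜 := 𝕜) (φ := fun x => (‖x i‖ ^ 2) ^ 4) (by fun_prop) v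
    have i2 := integrable_unitaryHaar_mulVec (𝕜 := 𝕜) (φ := fun x => (‖x (τ i)‖ ^ 2) ^ 4)
      (by fun_prop) v
    have := integral_mono (integrable_unitaryHaar_mulVec (𝕜 := 𝕜) (φ := fun x => coordDiff τ i x ^ 4)
      ((c i).pow 4) v) (i1.add i2) (fun U => by
        simp only [coordDiff, Pi.add_apply]
        have hA : 0 ≤ ‖(U.1 *ᵥ v) i‖ ^ 2 := by positivity
        have hB : 0 ≤ ‖(U.1 *ᵥ v) (τ i)‖ ^ 2 := by positivity
        generalize ‖(U.1 *ᵥ v) i‖ ^ 2 = A at *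
        generalize ‖(U.1 *ᵥ v) (τ i)‖ ^ 2 = B at *
        have e : (A - B) ^ 2 ≤ A ^ 2 + B ^ 2 := by nlinarith [mul_nonneg hA hB]
        have e2 : ((A - B) ^ 2) ^ 2 = (A - B) ^ 4 := by ring
        rw [← e2]
        rcases le_total A B with h | h
        · have : (A - B) ^ 2 ≤ B ^ 2 := by nlinarith
          nlinarith [pow_le_pow_left₀ (sq_nonneg _) this 2, pow_nonneg hA 4]
        · have : (A - B) ^ 2 ≤ A ^ 2 := by nlinarith
          nlinarith [pow_le_pow_left₀ (sq_nonneg _) this 2, pow_nonneg hB 4])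
    rw [integral_add' i1 i2] at this
    linarith [hM i, hM (τ i)]
  refine (abs_integral_le_integral_abs).trans ?_
  have q := fun i => integrable_unitaryHaar_mulVec (𝕜 := 𝕜) (φ := fun x => coordDiff τ i x ^ 4)
      ((c i).pow 4) v
  have := integral_mono (integrable_unitaryHaar_mulVec (𝕜 := 𝕜) (φ := fun x =>
      |coordDiff τ i x * coordDiff τ j x * coordDiff τ l x * coordDiff τ m x|)
      ((((c i).mul (c j)).mul (c l)).mul (c m)).abs v)
    ((((q i).add (q j)).add ((q l).add (q m))).const_mul (1 / 4)) (fun U => by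
      simp only [Pi.add_apply]
      generalize coordDiff τ i (U.1 *ᵥ v) = a
      generalize coordDiff τ j (U.1 *ᵥ v) = b
      generalize coordDiff τ l (U.1 *ᵥ v) = d
      generalize coordDiff τ m (U.1 *ᵥ v) = e
      rw [abs_le]
      constructor <;>
      nlinarith [sq_nonneg (a * b + d * e), sq_nonneg (a * b - d * e), sq_nonneg (a ^ 2 - b ^ 2),
        sq_nonneg (d ^ 2 - e ^ 2)])
  rw [integral_const_mul, integral_add' ((q i).add (q j)) ((q l).add (q m)),
    integral_add' (q i) (q j), integral_add' (q l) (q m)] at this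
  linarith [four i, four j, four l, four m]

/-- Only quadruples of indices that pair up within orbits of `τ` contribute: three pairings with
total weight `4 n ^ 2` each, every term being at most `2 * M * C ^ 4`. -/
theorem integral_sum_coordDiff_pow_four_le {v : ι → 𝕜} {M : ℝ}
    (hM : ∀ i, ∫ U, (‖(U.1 *ᵥ v) i‖ ^ 2) ^ 4 ∂(unitaryHaar ι 𝕜) ≤ M)
    {τ : Equiv.Perm ι} (hτ : ∀ i, τ (τ i) = i) {c : ι → ℝ} {C : ℝ} (hc : ∀ i, |c i| ≤ C) :
    ∫ U, (∑ i, c i * coordDiff τ i (U.1 *ᵥ v)) ^ 4 ∂(unitaryHaar ι 𝕜) ≤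
      24 * (Fintype.card ι : ℝ) ^ 2 * C ^ 4 * M := by
  rcases isEmpty_or_nonempty ι with hι | ⟨⟨i₀⟩⟩
  · simp
  have hC : 0 ≤ C := (abs_nonneg _).trans (hc i₀)
  have hM0 : 0 ≤ M := (integral_nonneg fun U => by positivity).trans (hM i₀)
  have cont := continuous_coordDiff (𝕜 := 𝕜) τ
  have ci : ∀ i j l m, Integrable (fun U : unitaryGroup ι 𝕜 =>
      c i * coordDiff τ i (U.1 *ᵥ v) * (c j * coordDiff τ j (U.1 *ᵥ v)) *
      (c l * coordDiff τ l (U.1 *ᵥ v)) * (c m * coordDiff τ m (U.1 *ᵥ v))) (unitaryHaar ι 𝕜) := by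
    intro i j l m
    exact integrable_unitaryHaar_mulVec (φ := fun x => c i * coordDiff τ i x *
      (c j * coordDiff τ j x) * (c l * coordDiff τ l x) * (c m * coordDiff τ m x))
      ((((continuous_const.mul (cont i)).mul (continuous_const.mul (cont j))).mul
        (continuous_const.mul (cont l))).mul (continuous_const.mul (cont m))) v
  simp only [sum_pow_four_expand]
  rw [integral_finsetSum _ fun i _ => integrable_finsetSum _ fun j _ =>
    integrable_finsetSum _ fun l _ => integrable_finsetSum _ fun m _ => ci i j l m]
  simp only [integral_finsetSum _ fun j _ => integrable_finsetSum _ fun l _ =>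
    integrable_finsetSum _ fun m _ => ci _ j l m,
    integral_finsetSum _ fun l _ => integrable_finsetSum _ fun m _ => ci _ _ l m,
    integral_finsetSum _ fun m _ => ci _ _ _ m]
  -- At least one when `j` lies in the `τ`-orbit of `i`. A fixed point of `τ` is counted twice, so
  -- each row sums to exactly `2`.
  let δ : ι → ι → ℝ := fun i j => (if j = i then 1 else 0) + (if j = τ i then 1 else 0)
  have hδ0 : ∀ i j, 0 ≤ δ i j := fun i j => by
    simp only [δ]; split_ifs <;> norm_num
  have hδ1 : ∀ i j, (j = i ∨ j = τ i) → 1 ≤ δ i j := fun i j h => by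
    simp only [δ]; rcases h with h | h <;> simp [h] <;> split_ifs <;> norm_num
  have hδs : ∀ i, ∑ j, δ i j = 2 := fun i => by
    simp only [δ, Finset.sum_add_distrib]; norm_num
  have term : ∀ i j l m, ∫ U, c i * coordDiff τ i (U.1 *ᵥ v) * (c j * coordDiff τ j (U.1 *ᵥ v)) *
      (c l * coordDiff τ l (U.1 *ᵥ v)) * (c m * coordDiff τ m (U.1 *ᵥ v)) ∂(unitaryHaar ι 𝕜) ≤
      C ^ 4 * (2 * M) * (δ i j * δ l m + δ i l * δ j m + δ i m * δ j l) := by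
    intro i j l m
    have e : ∀ U : unitaryGroup ι 𝕜, c i * coordDiff τ i (U.1 *ᵥ v) *
        (c j * coordDiff τ j (U.1 *ᵥ v)) *
        (c l * coordDiff τ l (U.1 *ᵥ v)) * (c m * coordDiff τ m (U.1 *ᵥ v)) =
        (c i * c j * c l * c m) * (coordDiff τ i (U.1 *ᵥ v) * coordDiff τ j (U.1 *ᵥ v) *
          coordDiff τ l (U.1 *ᵥ v) * coordDiff τ m (U.1 *ᵥ v)) := fun U => by ring
    simp only [e, integral_const_mul]
    have hrhs : 0 ≤ δ i j * δ l m + δ i l * δ j m + δ i m * δ j l := by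
      have := mul_nonneg (hδ0 i j) (hδ0 l m)
      have := mul_nonneg (hδ0 i l) (hδ0 j m)
      have := mul_nonneg (hδ0 i m) (hδ0 j l)
      linarith
    by_cases hz : ∫ U, coordDiff τ i (U.1 *ᵥ v) * coordDiff τ j (U.1 *ᵥ v) *
        coordDiff τ l (U.1 *ᵥ v) * coordDiff τ m (U.1 *ᵥ v) ∂(unitaryHaar ι 𝕜) = 0
    · rw [hz, mul_zero]; positivity
    -- A nonzero integral leaves no index alone in its orbit. Being in the same orbit is an
    -- equivalence relation, so the four indices split into two pairs.
    have pair : 1 ≤ δ i j * δ l m + δ i l * δ j m + δ i m * δ j l := by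
      have rel : ∀ a b d e, (∫ U, coordDiff τ a (U.1 *ᵥ v) * coordDiff τ b (U.1 *ᵥ v) *
          coordDiff τ d (U.1 *ᵥ v) * coordDiff τ e (U.1 *ᵥ v) ∂(unitaryHaar ι 𝕜) ≠ 0) →
          (b = a ∨ b = τ a) ∨ (d = a ∨ d = τ a) ∨ (e = a ∨ e = τ a) := by
        intro a b d e h
        by_contra! hcon
        exact h (integral_coordDiff_mul_eq_zero hτ hcon.1 hcon.2.1 hcon.2.2 v)
      have hi := rel i j l m hz
      have hj := rel j i l m (by convert hz using 3; ring)
      have hl := rel l i j m (by convert hz using 3; ring)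
      have hm := rel m i j l (by convert hz using 3; ring)
      have hcases : ((j = i ∨ j = τ i) ∧ (m = l ∨ m = τ l)) ∨
          ((l = i ∨ l = τ i) ∧ (m = j ∨ m = τ j)) ∨ ((m = i ∨ m = τ i) ∧ (l = j ∨ l = τ j)) := by
        have hs : ∀ a b, b = τ a → a = τ b := fun a b h => by rw [h, hτ]
        grind
      have n1 := mul_nonneg (hδ0 i j) (hδ0 l m)
      have n2 := mul_nonneg (hδ0 i l) (hδ0 j m)
      have n3 := mul_nonneg (hδ0 i m) (hδ0 j l)
      rcases hcases with h | h | h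
      · linarith [one_le_mul_of_one_le_of_one_le (hδ1 _ _ h.1) (hδ1 _ _ h.2)]
      · linarith [one_le_mul_of_one_le_of_one_le (hδ1 _ _ h.1) (hδ1 _ _ h.2)]
      · linarith [one_le_mul_of_one_le_of_one_le (hδ1 _ _ h.1) (hδ1 _ _ h.2)]
    have hcc : |c i * c j * c l * c m| ≤ C ^ 4 := by
      rw [abs_mul, abs_mul, abs_mul]
      calc |c i| * |c j| * |c l| * |c m| ≤ C * C * C * C := by gcongr <;> apply hc
        _ = C ^ 4 := by ring
    calc _ ≤ |(c i * c j * c l * c m) * ∫ U, coordDiff τ i (U.1 *ᵥ v) * coordDiff τ j (U.1 *ᵥ v) *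
          coordDiff τ l (U.1 *ᵥ v) * coordDiff τ m (U.1 *ᵥ v) ∂(unitaryHaar ι 𝕜)| := le_abs_self _
      _ ≤ C ^ 4 * (2 * M) := by
          rw [abs_mul]
          gcongr
          exact abs_integral_coordDiff_mul_le hM τ i j l m
      _ ≤ _ := le_mul_of_one_le_right (by positivity) pair
  refine (Finset.sum_le_sum fun i _ => Finset.sum_le_sum fun j _ => Finset.sum_le_sum fun l _ =>
    Finset.sum_le_sum fun m _ => term i j l m).trans (le_of_eq ?_)
  have s1 : ∑ i, ∑ j, ∑ l, ∑ m, δ i j * δ l m = 4 * (Fintype.card ι : ℝ) ^ 2 := by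
    simp only [← Finset.mul_sum, hδs, Finset.sum_const, ← Finset.sum_mul, Finset.card_univ,
      nsmul_eq_mul]
    ring
  have s2 : ∑ i, ∑ j, ∑ l, ∑ m, δ i l * δ j m = 4 * (Fintype.card ι : ℝ) ^ 2 := by
    simp only [← Finset.mul_sum, hδs, Finset.sum_const, ← Finset.sum_mul, Finset.card_univ,
      nsmul_eq_mul]
    ring
  have s3 : ∑ i, ∑ j, ∑ l, ∑ m, δ i m * δ j l = 4 * (Fintype.card ι : ℝ) ^ 2 := by
    simp only [← Finset.sum_mul, ← Finset.mul_sum, hδs, Finset.sum_const, Finset.card_univ,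
      nsmul_eq_mul]
    ring
  simp only [← Finset.mul_sum, Finset.sum_add_distrib] at s1 s2 s3 ⊢
  rw [s1, s2, s3]
  ring

/-- Fourth-moment bound for a centred linear form in the squared coordinates of a Haar-random unit
vector. -/
theorem integral_centered_form_pow_four_le [AddCommGroup ι] {v : ι → 𝕜}
    (hv : ∑ i, ‖v i‖ ^ 2 = 1) (hn : 2 ≤ Fintype.card ι) {d : ι → ℝ} {D : ℝ} (hd : ∀ i, |d i| ≤ D)
    (hsum : ∑ i, d i = 0) :
    ∫ U, (∑ i, d i * ‖(U.1 *ᵥ v) i‖ ^ 2) ^ 4 ∂(unitaryHaar ι 𝕜) ≤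
      25920 * D ^ 4 / (Fintype.card ι : ℝ) ^ 2 := by
  have hn0 : (0 : ℝ) < Fintype.card ι := by
    have : (2 : ℝ) ≤ Fintype.card ι := by exact_mod_cast hn
    linarith
  have hM : ∀ i, ∫ U, (‖(U.1 *ᵥ v) i‖ ^ 2) ^ 4 ∂(unitaryHaar ι 𝕜) ≤
      1080 / (Fintype.card ι : ℝ) ^ 4 := fun i => by
    rw [le_div_iff₀ (by positivity), mul_comm]
    exact card_pow_mul_integral_coord_pow_four_le hv hn i
  -- The group structure supplies the involutions `i ↦ k - i`; each ordered pair `(i, j)` is matched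
  -- by exactly one of them, `k = i + j`. As the `d i` sum to zero, the `S k` add up to `2n` times
  -- the form.
  let S : ι → (ι → 𝕜) → ℝ := fun k x =>
    ∑ i, (d i - d (k - i)) * coordDiff (Equiv.subLeft k) i x
  have hSc : ∀ k, Continuous (S k) := fun k =>
    continuous_finsetSum _ fun i _ => continuous_const.mul (continuous_coordDiff _ i)
  have hS : ∀ x : ι → 𝕜, ∑ k, S k x = 2 * (Fintype.card ι : ℝ) * ∑ i, d i * ‖x i‖ ^ 2 := by
    intro x
    simp only [S]
    rw [Finset.sum_comm]
    have : ∀ i, ∑ k, (d i - d (k - i)) * coordDiff (Equiv.subLeft k) i x =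
        ∑ j, (d i - d j) * (‖x i‖ ^ 2 - ‖x j‖ ^ 2) := fun i =>
      Fintype.sum_equiv (Equiv.subRight i) _ _ fun k => by simp [coordDiff]
    simp only [this]
    simp only [sub_mul, mul_sub, Finset.sum_sub_distrib, Finset.sum_const, Finset.card_univ,
      nsmul_eq_mul]
    simp only [← Finset.mul_sum, ← Finset.sum_mul, hsum]
    ring
  have hpt : ∀ x : ι → 𝕜, (∑ i, d i * ‖x i‖ ^ 2) ^ 4 ≤
      (1 / (16 * (Fintype.card ι : ℝ))) * ∑ k, S k x ^ 4 := by
    intro x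
    -- Jensen's inequality for the mean over `k`; no cancellation between different `S k` is needed.
    have := Real.pow_arith_mean_le_arith_mean_pow_of_even Finset.univ
      (fun _ => (Fintype.card ι : ℝ)⁻¹) (fun k => S k x) (fun _ _ => by positivity)
      (by simp [Finset.card_univ, hn0.ne']) (n := 4) (by decide)
    rw [← Finset.mul_sum, ← Finset.mul_sum, hS] at this
    have e : (Fintype.card ι : ℝ)⁻¹ * (2 * (Fintype.card ι : ℝ) * ∑ i, d i * ‖x i‖ ^ 2) =
        2 * ∑ i, d i * ‖x i‖ ^ 2 := by field_simp
    rw [e, mul_pow] at this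
    have e2 : (1 / (16 * (Fintype.card ι : ℝ))) * ∑ k, S k x ^ 4 =
        (1 / 16) * ((Fintype.card ι : ℝ)⁻¹ * ∑ k, S k x ^ 4) := by field_simp
    rw [e2]
    linarith
  have hI : ∀ k, ∫ U, S k (U.1 *ᵥ v) ^ 4 ∂(unitaryHaar ι 𝕜) ≤
      24 * (Fintype.card ι : ℝ) ^ 2 * (2 * D) ^ 4 * (1080 / (Fintype.card ι : ℝ) ^ 4) := fun k =>
    integral_sum_coordDiff_pow_four_le hM (fun i => by simp) fun i => by
      refine (abs_sub _ _).trans ?_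
      linarith [hd i, hd (k - i)]
  have ic : ∀ k ∈ Finset.univ, Integrable (fun U : unitaryGroup ι 𝕜 => S k (U.1 *ᵥ v) ^ 4)
      (unitaryHaar ι 𝕜) := fun k _ => integrable_unitaryHaar_mulVec (φ := fun x => S k x ^ 4)
      ((hSc k).pow 4) v
  calc _ ≤ ∫ U, (1 / (16 * (Fintype.card ι : ℝ))) * ∑ k, S k (U.1 *ᵥ v) ^ 4 ∂(unitaryHaar ι 𝕜) :=
        integral_mono (integrable_unitaryHaar_mulVec (𝕜 := 𝕜)
          (φ := fun x => (∑ i, d i * ‖x i‖ ^ 2) ^ 4) (by fun_prop) v)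
          ((integrable_finsetSum _ ic).const_mul _) fun U => hpt _
    _ ≤ (1 / (16 * (Fintype.card ι : ℝ))) * ∑ k : ι, 24 * (Fintype.card ι : ℝ) ^ 2 * (2 * D) ^ 4 *
          (1080 / (Fintype.card ι : ℝ) ^ 4) := by
        rw [integral_const_mul, integral_finsetSum _ ic]
        gcongr with k
        exact hI k
    _ = 25920 * D ^ 4 / (Fintype.card ι : ℝ) ^ 2 := by
        rw [Finset.sum_const, Finset.card_univ, nsmul_eq_mul]
        field_simp
        ring

end fourthMoment

/-! ### The moment gap between the spectral measure at `v` and the empirical measure. -/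

section traceDev
variable {𝕜 : Type*} [RCLike 𝕜] {ι : Type*} [Fintype ι] [DecidableEq ι]

/-- The operator norm of a matrix acting on Euclidean space. -/
def l2Norm (A : Matrix ι ι 𝕜) : ℝ := ‖Matrix.toEuclideanCLM (n := ι) (𝕜 := 𝕜) A‖

theorem continuous_l2Norm : Continuous (l2Norm (𝕜 := 𝕜) (ι := ι)) := by
  unfold l2Norm
  exact ((Matrix.toEuclideanCLM (n := ι) (𝕜 := 𝕜)).toAlgEquiv.toLinearEquiv.toLinearMap.continuous_of_finiteDimensional).norm

theorem l2Norm_nonneg (A : Matrix ι ι 𝕜) : 0 ≤ l2Norm A := norm_nonneg _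

theorem l2Norm_conj (U : unitaryGroup ι 𝕜) (A : Matrix ι ι 𝕜) :
    l2Norm (U.1 * A * star U.1) = l2Norm A := by
  unfold l2Norm
  have h1 : Matrix.toEuclideanCLM (n := ι) (𝕜 := 𝕜) U.1 ∈ unitary _ := Unitary.map_mem _ U.2
  have h2 : Matrix.toEuclideanCLM (n := ι) (𝕜 := 𝕜) (star U.1) ∈ unitary _ :=
    Unitary.map_mem _ (Unitary.star_mem U.2)
  rw [map_mul, map_mul, CStarRing.norm_mul_mem_unitary _ h2, CStarRing.norm_mem_unitary_mul _ h1]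

theorem abs_eigenvalues_le_l2Norm {A : Matrix ι ι 𝕜} (hA : A.IsHermitian) (i : ι) :
    |hA.eigenvalues i| ≤ l2Norm A := by
  have h := (Matrix.toEuclideanCLM (n := ι) (𝕜 := 𝕜) A).le_opNorm (hA.eigenvectorBasis i)
  have h2 : Matrix.toEuclideanCLM (n := ι) (𝕜 := 𝕜) A (hA.eigenvectorBasis i) =
      (hA.eigenvalues i : 𝕜) • hA.eigenvectorBasis i := by
    ext j
    have := congrFun (hA.mulVec_eigenvectorBasis i) j
    simpa [RCLike.real_smul_eq_coe_mul] using this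
  rw [h2, norm_smul, OrthonormalBasis.norm_eq_one, mul_one, mul_one, RCLike.norm_ofReal] at h
  exact h

theorem l2Norm_le_of_abs_eigenvalues_le {A : Matrix ι ι 𝕜} (hA : A.IsHermitian) {K : ℝ}
    (hK : 0 ≤ K) (h : ∀ i, |hA.eigenvalues i| ≤ K) : l2Norm A ≤ K := by
  have e := hA.spectral_theorem
  rw [Unitary.conjStarAlgAut_apply] at e
  rw [e]
  refine (l2Norm_conj hA.eigenvectorUnitary _).trans_le ?_
  have : l2Norm (diagonal (RCLike.ofReal ∘ hA.eigenvalues) : Matrix ι ι 𝕜) =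
      ‖(RCLike.ofReal ∘ hA.eigenvalues : ι → 𝕜)‖ :=
    Matrix.l2_opNorm_diagonal _
  rw [this]
  exact (pi_norm_le_iff_of_nonneg hK).2 fun i => by simpa using h i

theorem conj_pow_eq (U : unitaryGroup ι 𝕜) (A : Matrix ι ι 𝕜) (k : ℕ) :
    (U.1 * A * star U.1) ^ k = U.1 * A ^ k * star U.1 := by
  have hU : star U.1 * U.1 = 1 := mem_unitaryGroup_iff'.1 U.2
  have hU' : U.1 * star U.1 = 1 := mem_unitaryGroup_iff.1 U.2
  induction k with
  | zero => simp [hU']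
  | succ k ih =>
    rw [pow_succ, ih, pow_succ]
    calc _ = U.1 * A ^ k * (star U.1 * U.1) * A * star U.1 := by simp only [Matrix.mul_assoc]
      _ = _ := by rw [hU, Matrix.mul_one]; simp only [Matrix.mul_assoc]

theorem trace_conj_eq (U : unitaryGroup ι 𝕜) (A : Matrix ι ι 𝕜) :
    (U.1 * A * star U.1).trace = A.trace := by
  rw [Matrix.trace_mul_comm, ← Matrix.mul_assoc, mem_unitaryGroup_iff'.1 U.2, Matrix.one_mul]

/-- The normalized difference of the `k`-th moments of the spectral measure of `A` at the
direction of the rank-one matrix `B` with eigenvalue `θ`, and of the empirical spectral measure. -/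
def momentGap (θ : ℝ) (k : ℕ) (A B : Matrix ι ι 𝕜) : ℝ :=
  (RCLike.re (A ^ k * B).trace / θ - RCLike.re (A ^ k).trace / Fintype.card ι) / (1 + l2Norm A ^ k)

/-- Traces and the operator norm are continuous in the matrices, so measurability follows with no
measurable choice of eigenvectors. -/
theorem continuous_momentGap (θ : ℝ) (k : ℕ) :
    Continuous fun p : Matrix ι ι 𝕜 × Matrix ι ι 𝕜 => momentGap θ k p.1 p.2 := by
  unfold momentGap
  have h := continuous_l2Norm (𝕜 := 𝕜) (ι := ι)
  refine Continuous.div ?_ (by fun_prop) fun p => ?_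
  · refine Continuous.sub (Continuous.div_const (RCLike.continuous_re.comp ?_) _)
      (Continuous.div_const (RCLike.continuous_re.comp ?_) _) <;> fun_prop
  · have := pow_nonneg (l2Norm_nonneg p.1) k
    positivity

theorem momentGap_conj (θ : ℝ) (k : ℕ) (U : unitaryGroup ι 𝕜) (A B : Matrix ι ι 𝕜) :
    momentGap θ k (U.1 * A * star U.1) (U.1 * B * star U.1) = momentGap θ k A B := by
  unfold momentGap
  have hU : star U.1 * U.1 = 1 := mem_unitaryGroup_iff'.1 U.2
  have : U.1 * A ^ k * star U.1 * (U.1 * B * star U.1) = U.1 * (A ^ k * B) * star U.1 := by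
    calc _ = U.1 * A ^ k * (star U.1 * U.1) * B * star U.1 := by simp only [Matrix.mul_assoc]
      _ = _ := by rw [hU, Matrix.mul_one]; simp only [Matrix.mul_assoc]
  rw [l2Norm_conj, conj_pow_eq, trace_conj_eq, this, trace_conj_eq]

theorem pow_eq_conj_diagonal {A : Matrix ι ι 𝕜} (hA : A.IsHermitian) (k : ℕ) :
    A ^ k = hA.eigenvectorUnitary.1 *
      diagonal (fun i => ((hA.eigenvalues i ^ k : ℝ) : 𝕜)) * star hA.eigenvectorUnitary.1 := by
  conv_lhs => rw [hA.spectral_theorem, Unitary.conjStarAlgAut_apply]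
  refine (conj_pow_eq hA.eigenvectorUnitary _ k).trans ?_
  rw [Matrix.diagonal_pow]
  congr 3
  ext i
  simp

theorem re_trace_pow {A : Matrix ι ι 𝕜} (hA : A.IsHermitian) (k : ℕ) :
    RCLike.re (A ^ k).trace = ∑ i, hA.eigenvalues i ^ k := by
  rw [pow_eq_conj_diagonal hA, trace_conj_eq, Matrix.trace_diagonal, ← RCLike.ofReal_sum,
    RCLike.ofReal_re]

theorem re_trace_pow_mul_vecMulVec {A : Matrix ι ι 𝕜} (hA : A.IsHermitian) (k : ℕ) (x : ι → 𝕜) :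
    RCLike.re (A ^ k * vecMulVec x (star x)).trace =
      ∑ i, hA.eigenvalues i ^ k * ‖(star hA.eigenvectorUnitary.1 *ᵥ x) i‖ ^ 2 := by
  rw [pow_eq_conj_diagonal hA, Matrix.mul_vecMulVec, Matrix.trace_vecMulVec, ← Matrix.mulVec_mulVec,
    ← Matrix.mulVec_mulVec, dotProduct_comm, Matrix.dotProduct_mulVec]
  have : star x ᵥ* hA.eigenvectorUnitary.1 = star (star hA.eigenvectorUnitary.1 *ᵥ x) := by
    rw [Matrix.star_mulVec, Matrix.star_eq_conjTranspose, Matrix.conjTranspose_conjTranspose]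
  rw [this]
  set y := star hA.eigenvectorUnitary.1 *ᵥ x
  simp only [dotProduct, Matrix.mulVec_diagonal, Pi.star_apply, map_sum]
  refine Finset.sum_congr rfl fun i _ => ?_
  have : star (y i) * (((hA.eigenvalues i ^ k : ℝ) : 𝕜) * y i) =
      ((hA.eigenvalues i ^ k * ‖y i‖ ^ 2 : ℝ) : 𝕜) := by
    push_cast
    rw [← RCLike.conj_mul, RCLike.star_def]
    ring
  rw [this, RCLike.ofReal_re]

theorem conj_smul_vecMulVec (U : unitaryGroup ι 𝕜) (c : 𝕜) (v : ι → 𝕜) :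
    U.1 * (c • vecMulVec v (star v)) * star U.1 =
      c • vecMulVec (U.1 *ᵥ v) (star (U.1 *ᵥ v)) := by
  rw [Matrix.mul_smul, Matrix.smul_mul, Matrix.mul_vecMulVec, Matrix.vecMulVec_mul,
    Matrix.star_mulVec, Matrix.star_eq_conjTranspose]

theorem momentGap_smul_vecMulVec {θ : ℝ} (hθ : θ ≠ 0) (k : ℕ) {A : Matrix ι ι 𝕜}
    (hA : A.IsHermitian) (x : ι → 𝕜) :
    momentGap θ k A ((θ : 𝕜) • vecMulVec x (star x)) =
      (∑ i, hA.eigenvalues i ^ k * ‖(star hA.eigenvectorUnitary.1 *ᵥ x) i‖ ^ 2 -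
        (∑ i, hA.eigenvalues i ^ k) / Fintype.card ι) / (1 + l2Norm A ^ k) := by
  unfold momentGap
  rw [re_trace_pow hA, Matrix.mul_smul, Matrix.trace_smul, smul_eq_mul, RCLike.re_ofReal_mul,
    re_trace_pow_mul_vecMulVec hA, mul_div_cancel_left₀ _ hθ]

/-- In the eigenbasis of `A` the numerator is a centred form with coefficients at most `2 * l2Norm A
^ k`. The denominator absorbs that size, so the bound is uniform in `A` and needs no moment
assumption on it; `414720 = 2 ^ 4 * 25920`. -/
theorem integral_momentGap_pow_four_le [AddCommGroup ι] (hn : 2 ≤ Fintype.card ι) {θ : ℝ}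
    (hθ : θ ≠ 0) (k : ℕ) {A : Matrix ι ι 𝕜} (hA : A.IsHermitian) {v : ι → 𝕜}
    (hv : ∑ i, ‖v i‖ ^ 2 = 1) :
    ∫ U, momentGap θ k A (U.1 * ((θ : 𝕜) • vecMulVec v (star v)) * star U.1) ^ 4
      ∂(unitaryHaar ι 𝕜) ≤ 414720 / (Fintype.card ι : ℝ) ^ 2 := by
  have hn0 : (0 : ℝ) < Fintype.card ι := by
    have : (2 : ℝ) ≤ Fintype.card ι := by exact_mod_cast hn
    linarith
  set K := l2Norm A ^ k with hK
  have hK0 : 0 ≤ K := pow_nonneg (l2Norm_nonneg A) k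
  set s := (∑ i, hA.eigenvalues i ^ k) / Fintype.card ι with hs
  have hl : ∀ i, |hA.eigenvalues i ^ k| ≤ K := fun i => by
    rw [abs_pow]; exact pow_le_pow_left₀ (abs_nonneg _) (abs_eigenvalues_le_l2Norm hA i) k
  have hsK : |s| ≤ K := by
    rw [hs, abs_div, abs_of_pos hn0, div_le_iff₀ hn0]
    calc _ ≤ ∑ i, |hA.eigenvalues i ^ k| := Finset.abs_sum_le_sum_abs _ _
      _ ≤ ∑ _i : ι, K := Finset.sum_le_sum fun i _ => hl i
      _ = _ := by rw [Finset.sum_const, Finset.card_univ, nsmul_eq_mul, mul_comm]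
  have hW : ∀ U : unitaryGroup ι 𝕜,
      momentGap θ k A (U.1 * ((θ : 𝕜) • vecMulVec v (star v)) * star U.1) ^ 4 =
      (1 / (1 + K) ^ 4) * (∑ i, (hA.eigenvalues i ^ k - s) *
        ‖((star hA.eigenvectorUnitary).1 *ᵥ (U.1 *ᵥ v)) i‖ ^ 2) ^ 4 := by
    intro U
    rw [conj_smul_vecMulVec, momentGap_smul_vecMulVec hθ k hA, ← hs, ← hK, div_pow]
    have h1 : ∑ i, ‖((star hA.eigenvectorUnitary).1 *ᵥ (U.1 *ᵥ v)) i‖ ^ 2 = 1 := by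
      rw [sum_norm_sq_unitary_mulVec, sum_norm_sq_unitary_mulVec, hv]
    simp only [sub_mul, Finset.sum_sub_distrib]
    rw [← Finset.mul_sum, h1, mul_one, one_div, inv_mul_eq_div]
    rfl
  simp only [hW]
  rw [integral_const_mul, integral_unitaryHaar_mulVec (fun x => (∑ i, (hA.eigenvalues i ^ k - s) *
    ‖x i‖ ^ 2) ^ 4) (star hA.eigenvectorUnitary) v]
  have h2 := integral_centered_form_pow_four_le hv hn (d := fun i => hA.eigenvalues i ^ k - s)
    (D := 2 * K) (fun i => by
      refine (abs_sub _ _).trans ?_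
      linarith [hl i]) (by
      rw [Finset.sum_sub_distrib, Finset.sum_const, Finset.card_univ, nsmul_eq_mul, hs]
      field_simp
      ring)
  calc _ ≤ (1 / (1 + K) ^ 4) * (25920 * (2 * K) ^ 4 / (Fintype.card ι : ℝ) ^ 2) := by gcongr
    _ = (414720 / (Fintype.card ι : ℝ) ^ 2) * (K / (1 + K)) ^ 4 := by field_simp; ring
    _ ≤ (414720 / (Fintype.card ι : ℝ) ^ 2) * 1 := by
        gcongr
        refine pow_le_one₀ (by positivity) ?_
        rw [div_le_one (by positivity)]
        linarith
    _ = _ := mul_one _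

end traceDev

/-! ### Almost sure convergence of the moment gaps. -/

section probability
variable {𝕜 : Type*} [RCLike 𝕜]

/-- By independence the joint law is the product of the marginals. If `P` is invariant, the claim is
immediate; if `X` is, conjugating both arguments by `star U` moves the unitary from `P` to `X`. -/
theorem lintegral_conj_eq {ι : Type*} [Fintype ι] [DecidableEq ι]
    {Ω : Type*} [MeasurableSpace Ω] {Pr : Measure Ω} [IsProbabilityMeasure Pr]
    {X P : Ω → Matrix ι ι 𝕜} (hX : Measurable X) (hP : Measurable P) (hind : IndepFun X P Pr)
    (hinv : IsConjInvariant Pr X ∨ IsConjInvariant Pr P)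
    {g : Matrix ι ι 𝕜 × Matrix ι ι 𝕜 → ENNReal} (hg : Measurable g)
    (hgc : ∀ (U : unitaryGroup ι 𝕜) A B, g (U.1 * A * star U.1, U.1 * B * star U.1) = g (A, B))
    (U : unitaryGroup ι 𝕜) :
    ∫⁻ ω, g (X ω, U.1 * P ω * star U.1) ∂Pr = ∫⁻ ω, g (X ω, P ω) ∂Pr := by
  have key : ∀ X' P' : Ω → Matrix ι ι 𝕜, Measurable X' → Measurable P' → IndepFun X' P' Pr →
      Pr.map X' = Pr.map X → Pr.map P' = Pr.map P →
      ∫⁻ ω, g (X' ω, P' ω) ∂Pr = ∫⁻ ω, g (X ω, P ω) ∂Pr := by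
    intro X' P' hX' hP' hi e1 e2
    rw [← lintegral_map hg (hX'.prodMk hP'), ← lintegral_map hg (hX.prodMk hP),
      (indepFun_iff_map_prod_eq_prod_map_map hX'.aemeasurable hP'.aemeasurable).1 hi,
      (indepFun_iff_map_prod_eq_prod_map_map hX.aemeasurable hP.aemeasurable).1 hind, e1, e2]
  have hm : ∀ V : unitaryGroup ι 𝕜, Measurable fun A : Matrix ι ι 𝕜 => V.1 * A * star V.1 :=
    fun V => Continuous.measurable (by fun_prop)
  rcases hinv with h | h
  · rw [← key (fun ω => (star U).1 * X ω * star (star U).1) P ((hm (star U)).comp hX) hP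
      (hind.comp (hm (star U)) measurable_id) (h _ (star U).2) rfl]
    refine lintegral_congr fun ω => ?_
    rw [← hgc (star U)]
    congr 2
    have hU : star U.1 * U.1 = 1 := mem_unitaryGroup_iff'.1 U.2
    calc (star U).1 * (U.1 * P ω * star U.1) * star (star U).1
        = (star U.1 * U.1) * P ω * (star U.1 * U.1) := by
          simp only [Matrix.mul_assoc, Unitary.coe_star, star_star]
      _ = P ω := by rw [hU, Matrix.one_mul, Matrix.mul_one]
  · exact key X _ hX ((hm U).comp hP) (hind.comp measurable_id (hm U)) rfl (h _ U.2)

/-- The left side is unchanged on averaging over Haar unitaries acting on `P`; by Tonelli the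
average may be taken with `X ω` and `P ω` frozen, where the deterministic bound applies. -/
theorem lintegral_momentGap_pow_four_le {ι : Type*} [Fintype ι] [DecidableEq ι] [AddCommGroup ι]
    (hn : 2 ≤ Fintype.card ι)
    {Ω : Type*} [MeasurableSpace Ω] {Pr : Measure Ω} [IsProbabilityMeasure Pr]
    {X P : Ω → Matrix ι ι 𝕜} (hX : Measurable X) (hP : Measurable P) (hind : IndepFun X P Pr)
    (hinv : IsConjInvariant Pr X ∨ IsConjInvariant Pr P) (hXh : ∀ ω, (X ω).IsHermitian)
    {θ : ℝ} (hθ : θ ≠ 0)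
    (hform : ∀ ω, ∃ v : ι → 𝕜, ∑ i, ‖v i‖ ^ 2 = 1 ∧ P ω = (θ : 𝕜) • vecMulVec v (star v)) (k : ℕ) :
    ∫⁻ ω, ENNReal.ofReal (momentGap θ k (X ω) (P ω) ^ 4) ∂Pr ≤
      ENNReal.ofReal (414720 / (Fintype.card ι : ℝ) ^ 2) := by
  have hc := continuous_momentGap (𝕜 := 𝕜) (ι := ι) θ k
  have hg : Measurable fun p : Matrix ι ι 𝕜 × Matrix ι ι 𝕜 =>
      ENNReal.ofReal (momentGap θ k p.1 p.2 ^ 4) :=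
    (hc.pow 4).measurable.ennreal_ofReal
  have hinvar := lintegral_conj_eq hX hP hind hinv hg
    (fun U A B => by simp only [momentGap_conj])
  have hjoint : Measurable fun q : unitaryGroup ι 𝕜 × Ω =>
      ENNReal.ofReal (momentGap θ k (X q.2) (q.1.1 * P q.2 * star q.1.1) ^ 4) := by
    have h1 : Measurable fun r : unitaryGroup ι 𝕜 × Matrix ι ι 𝕜 × Matrix ι ι 𝕜 =>
        ENNReal.ofReal (momentGap θ k r.2.1 (r.1.1 * r.2.2 * star r.1.1) ^ 4) := by
      refine Measurable.ennreal_ofReal (Continuous.measurable ?_)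
      exact (hc.comp (f := fun r : unitaryGroup ι 𝕜 × Matrix ι ι 𝕜 × Matrix ι ι 𝕜 =>
        (r.2.1, r.1.1 * r.2.2 * star r.1.1)) (by fun_prop)).pow 4
    have h2 : Measurable fun q : unitaryGroup ι 𝕜 × Ω => (q.1, X q.2, P q.2) :=
      measurable_fst.prodMk ((hX.comp measurable_snd).prodMk (hP.comp measurable_snd))
    exact Measurable.comp (f := fun q : unitaryGroup ι 𝕜 × Ω => (q.1, X q.2, P q.2)) h1 h2
  calc ∫⁻ ω, ENNReal.ofReal (momentGap θ k (X ω) (P ω) ^ 4) ∂Pr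
      = ∫⁻ U, ∫⁻ ω, ENNReal.ofReal (momentGap θ k (X ω) (U.1 * P ω * star U.1) ^ 4) ∂Pr
          ∂(unitaryHaar ι 𝕜) := by
        simp only [hinvar, lintegral_const, measure_univ, mul_one]
    _ = ∫⁻ ω, ∫⁻ U, ENNReal.ofReal (momentGap θ k (X ω) (U.1 * P ω * star U.1) ^ 4)
          ∂(unitaryHaar ι 𝕜) ∂Pr := lintegral_lintegral_swap hjoint.aemeasurable
    _ ≤ ∫⁻ _, ENNReal.ofReal (414720 / (Fintype.card ι : ℝ) ^ 2) ∂Pr := by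
        refine lintegral_mono fun ω => ?_
        obtain ⟨v, hv, hPv⟩ := hform ω
        have hcont : Continuous fun U : unitaryGroup ι 𝕜 =>
            momentGap θ k (X ω) (U.1 * P ω * star U.1) ^ 4 :=
          (hc.comp (f := fun U : unitaryGroup ι 𝕜 => (X ω, U.1 * P ω * star U.1))
            (by fun_prop)).pow 4
        rw [← ofReal_integral_eq_lintegral_ofReal
          (hcont.integrable_of_hasCompactSupport (HasCompactSupport.of_compactSpace _))
          (Eventually.of_forall fun U => by positivity), hPv]
        exact ENNReal.ofReal_le_ofReal (integral_momentGap_pow_four_le hn hθ k (hXh ω) hv)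
    _ = _ := by simp

/-- The fourth powers have summable expectations, so their series converges almost surely. Index
`0`, a matrix of size one, is left out because the moment bound needs size at least two. -/
theorem ae_tendsto_zero_of_lintegral_pow_four_le {Ω : Type*} [MeasurableSpace Ω] {Pr : Measure Ω}
    [IsProbabilityMeasure Pr] {f : ℕ → Ω → ℝ} (hf : ∀ n, Measurable (f n)) {C : ℝ}
    (h : ∀ n, 1 ≤ n → ∫⁻ ω, ENNReal.ofReal (f n ω ^ 4) ∂Pr ≤
      ENNReal.ofReal (C / ((n : ℝ) + 1) ^ 2)) :
    ∀ᵐ ω ∂Pr, Tendsto (fun n => f n ω) atTop (𝓝 0) := by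
  have hm : ∀ n, Measurable fun ω => ENNReal.ofReal (f (n + 1) ω ^ 4) :=
    fun n => ((hf _).pow_const 4).ennreal_ofReal
  have hs : Summable fun n : ℕ => C / (((n + 1 : ℕ) : ℝ) + 1) ^ 2 := by
    have := (summable_nat_add_iff 2).2 (Real.summable_one_div_nat_pow.2 one_lt_two)
    refine (this.mul_left C).congr fun n => ?_
    push_cast
    ring
  have hfin : ∫⁻ ω, ∑' n, ENNReal.ofReal (f (n + 1) ω ^ 4) ∂Pr ≠ ⊤ := by
    rw [lintegral_tsum fun n => (hm n).aemeasurable]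
    refine ne_top_of_le_ne_top hs.tsum_ofReal_ne_top (ENNReal.tsum_le_tsum fun n => ?_)
    exact h (n + 1) (by omega)
  filter_upwards [ae_lt_top (Measurable.tsum hm) hfin] with ω hω
  have h0 := ENNReal.tendsto_atTop_zero_of_tsum_ne_top hω.ne
  have h1 : Tendsto (fun n => f (n + 1) ω ^ 4) atTop (𝓝 0) := by
    have := (ENNReal.tendsto_toReal ENNReal.zero_ne_top).comp h0
    refine this.congr fun n => ?_
    simp only [Function.comp]
    rw [ENNReal.toReal_ofReal (by positivity)]
  rw [← tendsto_add_atTop_iff_nat 1]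
  have h2 := (h1.sqrt).sqrt
  simp only [Real.sqrt_zero] at h2
  refine (tendsto_zero_iff_abs_tendsto_zero _).2 (h2.congr fun n => ?_)
  rw [show f (n + 1) ω ^ 4 = (f (n + 1) ω ^ 2) ^ 2 by ring, Real.sqrt_sq (by positivity),
    Real.sqrt_sq_eq_abs]
  rfl

theorem measurable_momentGap {ι : Type*} [Fintype ι] [DecidableEq ι] {Ω : Type*}
    [MeasurableSpace Ω] (θ : ℝ) (k : ℕ) {X P : Ω → Matrix ι ι 𝕜} (hX : Measurable X)
    (hP : Measurable P) : Measurable fun ω => momentGap θ k (X ω) (P ω) := by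
  have h1 : Measurable fun p : Matrix ι ι 𝕜 × Matrix ι ι 𝕜 => momentGap θ k p.1 p.2 :=
    (continuous_momentGap θ k).measurable
  have h2 : Measurable fun ω => (X ω, P ω) := hX.prodMk hP
  exact Measurable.comp (f := fun ω => (X ω, P ω)) h1 h2

theorem ae_tendsto_momentGap {Ω : Type*} [MeasurableSpace Ω] {Pr : Measure Ω}
    [IsProbabilityMeasure Pr] {X P : ∀ n : ℕ, Ω → Matrix (Fin (n + 1)) (Fin (n + 1)) 𝕜}
    (hX : ∀ n, Measurable (X n)) (hP : ∀ n, Measurable (P n))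
    (hXh : ∀ n ω, (X n ω).IsHermitian) (hind : ∀ n, IndepFun (X n) (P n) Pr)
    (hinv : ∀ n, IsConjInvariant Pr (X n) ∨ IsConjInvariant Pr (P n)) {θ : ℝ} (hθ : θ ≠ 0)
    (hform : ∀ n ω, ∃ v : Fin (n + 1) → 𝕜, ∑ i, ‖v i‖ ^ 2 = 1 ∧
      P n ω = (θ : 𝕜) • vecMulVec v (star v)) :
    ∀ᵐ ω ∂Pr, ∀ k, Tendsto (fun n => momentGap θ k (X n ω) (P n ω)) atTop (𝓝 0) := by
  refine ae_all_iff.2 fun k => ae_tendsto_zero_of_lintegral_pow_four_le (C := 414720)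
    (fun n => measurable_momentGap θ k (hX n) (hP n)) fun n hn => ?_
  have := lintegral_momentGap_pow_four_le (by simpa using hn) (hX n) (hP n) (hind n) (hinv n)
    (hXh n) hθ (hform n) k
  simpa using this

end probability

/-! ### Linear algebra of rank-one Hermitian perturbations. -/

section rankOne
variable {𝕜 : Type*} [RCLike 𝕜] {ι : Type*} [Fintype ι]

theorem star_dotProduct_self_eq (x : ι → 𝕜) : star x ⬝ᵥ x = ((∑ i, ‖x i‖ ^ 2 : ℝ) : 𝕜) := by
  simp [dotProduct, RCLike.conj_mul]

variable [DecidableEq ι]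

/-- The range is the line of a unit eigenvector `v`, so `A y = c v`, and self-adjointness gives `c =
⟨v, A y⟩ = θ ⟨v, y⟩`. -/
theorem exists_eq_smul_vecMulVec {A : Matrix ι ι 𝕜} (hA : A.IsHermitian) (hrank : A.rank = 1)
    {θ : ℝ} (hθ : θ ≠ 0) (heig : Module.End.HasEigenvalue (Matrix.toLin' A) (θ : 𝕜)) :
    ∃ v : ι → 𝕜, ∑ i, ‖v i‖ ^ 2 = 1 ∧ A = (θ : 𝕜) • vecMulVec v (star v) := by
  obtain ⟨w, hw⟩ := heig.exists_hasEigenvector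
  have hw0 : w ≠ 0 := hw.2
  have hAw : A *ᵥ w = (θ : 𝕜) • w := by simpa using hw.apply_eq_smul
  have hθ' : (θ : 𝕜) ≠ 0 := by simpa using hθ
  set s := ∑ i, ‖w i‖ ^ 2 with hs
  have hs0 : 0 < s := by
    obtain ⟨i, hi⟩ := Function.ne_iff.1 hw0
    have hi' : w i ≠ 0 := hi
    exact Finset.sum_pos' (fun _ _ => by positivity) ⟨i, Finset.mem_univ i, by positivity⟩
  let v : ι → 𝕜 := ((√s)⁻¹ : ℝ) • w
  have hv1 : ∑ i, ‖v i‖ ^ 2 = 1 := by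
    simp only [v, Pi.smul_apply, norm_smul, mul_pow, ← Finset.mul_sum, ← hs]
    rw [Real.norm_eq_abs, sq_abs, inv_pow, Real.sq_sqrt hs0.le, inv_mul_cancel₀ hs0.ne']
  have hAv : A *ᵥ v = (θ : 𝕜) • v := by
    simp only [v, Matrix.mulVec_smul, hAw]
    exact smul_comm _ _ _
  have hv0 : v ≠ 0 := by
    rintro h
    simp [h] at hv1
  have hrange : ∀ y, ∃ c : 𝕜, A *ᵥ y = c • v := by
    intro y
    have hmem : v ∈ LinearMap.range A.mulVecLin :=
      ⟨(θ : 𝕜)⁻¹ • v, by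
        rw [Matrix.mulVecLin_apply, Matrix.mulVec_smul, hAv, inv_smul_smul₀ hθ']⟩
    have := (finrank_eq_one_iff_of_nonzero' (⟨v, hmem⟩ : LinearMap.range A.mulVecLin)
      (by simpa using hv0)).1 hrank ⟨A *ᵥ y, ⟨y, rfl⟩⟩
    obtain ⟨c, hc⟩ := this
    exact ⟨c, (congrArg Subtype.val hc).symm⟩
  clear_value v
  refine ⟨v, hv1, ?_⟩
  have hstar : star v ᵥ* A = (θ : 𝕜) • star v := by
    have := congrArg star hAv
    rw [Matrix.star_mulVec, hA.eq, star_smul, RCLike.star_def, RCLike.conj_ofReal] at this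
    exact this
  refine Matrix.ext_of_mulVec_single fun i => ?_
  generalize (Pi.single i 1 : ι → 𝕜) = y
  obtain ⟨c, hc⟩ := hrange y
  have h1 : star v ⬝ᵥ (A *ᵥ y) = c := by
    rw [hc, dotProduct_smul, star_dotProduct_self_eq, hv1]
    simp
  rw [Matrix.dotProduct_mulVec, hstar, smul_dotProduct] at h1
  rw [hc, ← h1, Matrix.smul_mulVec, Matrix.vecMulVec_mulVec]
  ext j
  simp only [Pi.smul_apply, smul_eq_mul, MulOpposite.smul_eq_mul_unop, MulOpposite.unop_op]
  ring

/-- The projection `z` is a multiple of `v`, and `‖z‖ ^ 2 = ⟨z, u⟩`; cancelling one factor `‖z‖`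
gives the bound. -/
theorem projNorm_kerSub_le {θ : ℝ} (hθ : θ ≠ 0) {v : ι → 𝕜} (hv : ∑ i, ‖v i‖ ^ 2 = 1) (u : EuclideanSpace 𝕜 ι) :
    projNorm u (kerSub θ ((θ : 𝕜) • vecMulVec v (star v))) ≤ ‖star v ⬝ᵥ u.ofLp‖ := by
  unfold projNorm
  set F := kerSub θ ((θ : 𝕜) • vecMulVec v (star v)) with hF
  set z := F.orthogonalProjectionOnto u with hz
  have hθ' : (θ : 𝕜) ≠ 0 := by simpa using hθ
  have hker : ((θ : 𝕜) • (1 : Matrix ι ι 𝕜) - (θ : 𝕜) • vecMulVec v (star v)) *ᵥ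
      (z : EuclideanSpace 𝕜 ι).ofLp = 0 := by
    have h1 : Matrix.toEuclideanLin ((θ : 𝕜) • (1 : Matrix ι ι 𝕜) - (θ : 𝕜) • vecMulVec v (star v))
        (z : EuclideanSpace 𝕜 ι) = 0 := LinearMap.mem_ker.1 z.2
    exact congrArg WithLp.ofLp h1
  rw [← smul_sub, Matrix.smul_mulVec, smul_eq_zero, or_iff_right hθ', Matrix.sub_mulVec,
    Matrix.one_mulVec, Matrix.vecMulVec_mulVec, sub_eq_zero] at hker
  set c := star v ⬝ᵥ (z : EuclideanSpace 𝕜 ι).ofLp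
  have hzn : ‖z‖ ^ 2 = ‖c‖ ^ 2 := by
    rw [← Submodule.norm_coe, EuclideanSpace.norm_sq_eq, hker]
    simp only [Pi.smul_apply, norm_smul, mul_pow, ← Finset.mul_sum, hv, mul_one,
      MulOpposite.norm_op]
  have hin : inner 𝕜 z z = inner 𝕜 (z : EuclideanSpace 𝕜 ι) u :=
    Submodule.inner_orthogonalProjectionOnto_eq_of_mem_left z u
  have hin2 : ‖z‖ ^ 2 ≤ ‖c‖ * ‖star v ⬝ᵥ u.ofLp‖ := by
    have h1 : ‖(inner 𝕜 z z : 𝕜)‖ = ‖z‖ ^ 2 := by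
      rw [inner_self_eq_norm_sq_to_K, norm_pow, RCLike.norm_ofReal, abs_norm]
    rw [← h1, hin, EuclideanSpace.inner_eq_star_dotProduct, hker, dotProduct_comm, star_smul,
      smul_dotProduct, norm_smul, norm_star, MulOpposite.norm_op]
  have hzc : ‖z‖ = ‖c‖ := (sq_eq_sq₀ (norm_nonneg _) (norm_nonneg _)).1 hzn
  rw [← hzc] at hin2
  rcases (norm_nonneg z).eq_or_lt with h0 | h0
  · rw [← h0]; exact norm_nonneg _
  · exact le_of_mul_le_mul_left (by rwa [← sq]) h0

/-- Spectral form of the eigenvector equation of a rank-one perturbation. -/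
theorem perturbed_eigenvector_coord {A : Matrix ι ι 𝕜} (hA : A.IsHermitian) {θ L : ℝ}
    {v u : ι → 𝕜} (h : (A + (θ : 𝕜) • vecMulVec v (star v)) *ᵥ u = (L : 𝕜) • u) (i : ι) :
    |θ| * ‖star v ⬝ᵥ u‖ * ‖(star hA.eigenvectorUnitary.1 *ᵥ v) i‖ =
      |L - hA.eigenvalues i| * ‖(star hA.eigenvectorUnitary.1 *ᵥ u) i‖ := by
  set V := hA.eigenvectorUnitary with hV
  have hVV : star V.1 * V.1 = 1 := mem_unitaryGroup_iff'.1 V.2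
  have h1 : star V.1 *ᵥ (A *ᵥ u) =
      diagonal (fun i => (hA.eigenvalues i : 𝕜)) *ᵥ (star V.1 *ᵥ u) := by
    have := pow_eq_conj_diagonal hA 1
    simp only [pow_one] at this
    conv_lhs => rw [this]
    rw [Matrix.mulVec_mulVec, Matrix.mulVec_mulVec, ← Matrix.mul_assoc, ← Matrix.mul_assoc, ← hV,
      hVV, Matrix.one_mul]
  have h2 := congrFun (congrArg (fun x => star V.1 *ᵥ x) h) i
  simp only [Matrix.add_mulVec, Matrix.mulVec_add, h1, Matrix.smul_mulVec, Matrix.mulVec_smul,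
    Matrix.vecMulVec_mulVec, Pi.add_apply, Pi.smul_apply, Matrix.mulVec_diagonal, smul_eq_mul,
    MulOpposite.smul_eq_mul_unop, MulOpposite.unop_op] at h2
  have h3 : (θ : 𝕜) * (star v ⬝ᵥ u) * (star V.1 *ᵥ v) i =
      ((L - hA.eigenvalues i : ℝ) : 𝕜) * (star V.1 *ᵥ u) i := by
    push_cast
    linear_combination h2
  have h4 := congrArg norm h3
  simpa only [norm_mul, RCLike.norm_ofReal] using h4

theorem norm_star_dotProduct_le (V : unitaryGroup ι 𝕜) (v u : ι → 𝕜) :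
    ‖star v ⬝ᵥ u‖ ≤ ∑ i, ‖(V.1 *ᵥ v) i‖ * ‖(V.1 *ᵥ u) i‖ := by
  have : star v ⬝ᵥ u = star (V.1 *ᵥ v) ⬝ᵥ (V.1 *ᵥ u) := by
    rw [Matrix.star_mulVec, Matrix.dotProduct_mulVec, Matrix.vecMul_vecMul,
      ← Matrix.star_eq_conjTranspose, Matrix.mem_unitaryGroup_iff'.1 V.2, Matrix.vecMul_one]
  rw [this]
  refine (norm_sum_le _ _).trans (le_of_eq ?_)
  simp

theorem re_star_dotProduct_mulVec {A : Matrix ι ι 𝕜} (hA : A.IsHermitian) (x : ι → 𝕜) :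
    RCLike.re (star x ⬝ᵥ A *ᵥ x) =
      ∑ i, hA.eigenvalues i * ‖(star hA.eigenvectorUnitary.1 *ᵥ x) i‖ ^ 2 := by
  have := re_trace_pow_mul_vecMulVec hA 1 x
  simp only [pow_one] at this
  rw [← this, Matrix.mul_vecMulVec, Matrix.trace_vecMulVec, dotProduct_comm]

/-- The `i`-th eigenvector of `A` serves as test vector; by the variational principle the extreme
eigenvalue of `A + B` on the side of `θ` lies beyond every eigenvalue of `A`. -/
theorem exists_quadratic_form_perturbed {A B : Matrix ι ι 𝕜} (hA : A.IsHermitian) {θ : ℝ}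
    {v : ι → 𝕜} (hB : B = (θ : 𝕜) • vecMulVec v (star v)) (i : ι) :
    ∃ x : ι → 𝕜, ∑ j, ‖x j‖ ^ 2 = 1 ∧ ∃ c : ℝ, 0 ≤ c ∧
      RCLike.re (star x ⬝ᵥ (A + B) *ᵥ x) = hA.eigenvalues i + θ * c := by
  refine ⟨(hA.eigenvectorBasis i).ofLp, ?_, ‖star v ⬝ᵥ (hA.eigenvectorBasis i).ofLp‖ ^ 2,
    by positivity, ?_⟩
  · rw [← EuclideanSpace.norm_sq_eq, OrthonormalBasis.norm_eq_one, one_pow]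
  · have hx : ∑ j, ‖(hA.eigenvectorBasis i).ofLp j‖ ^ 2 = 1 := by
      rw [← EuclideanSpace.norm_sq_eq, OrthonormalBasis.norm_eq_one, one_pow]
    rw [hB, Matrix.add_mulVec, hA.mulVec_eigenvectorBasis, Matrix.smul_mulVec,
      Matrix.vecMulVec_mulVec]
    set x := (hA.eigenvectorBasis i).ofLp
    have h1 : star x ⬝ᵥ (hA.eigenvalues i • x) = ((hA.eigenvalues i : ℝ) : 𝕜) := by
      rw [dotProduct_smul, star_dotProduct_self_eq, hx]
      simp [RCLike.real_smul_eq_coe_mul]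
    have h2 : star x ⬝ᵥ ((θ : 𝕜) • MulOpposite.op (star v ⬝ᵥ x) • v) =
        ((θ * ‖star v ⬝ᵥ x‖ ^ 2 : ℝ) : 𝕜) := by
      have : star x ⬝ᵥ v = star (star v ⬝ᵥ x) := by
        rw [Matrix.star_dotProduct]
      rw [dotProduct_smul, dotProduct_smul, this]
      push_cast
      rw [← RCLike.conj_mul]
      rfl
    rw [dotProduct_add, h1, h2, map_add, RCLike.ofReal_re, RCLike.ofReal_re]

variable [Nonempty ι]

theorem re_star_dotProduct_mulVec_le {A : Matrix ι ι 𝕜} (hA : A.IsHermitian) {x : ι → 𝕜}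
    (hx : ∑ i, ‖x i‖ ^ 2 = 1) : RCLike.re (star x ⬝ᵥ A *ᵥ x) ≤ largestEigenvalue hA := by
  rw [re_star_dotProduct_mulVec hA]
  calc _ ≤ ∑ i, largestEigenvalue hA * ‖((star hA.eigenvectorUnitary).1 *ᵥ x) i‖ ^ 2 := by
        refine Finset.sum_le_sum fun i _ => mul_le_mul_of_nonneg_right ?_ (by positivity)
        exact Finset.le_sup' hA.eigenvalues (Finset.mem_univ i)
    _ = _ := by rw [← Finset.mul_sum, sum_norm_sq_unitary_mulVec, hx, mul_one]

theorem smallestEigenvalue_le_re_star_dotProduct_mulVec {A : Matrix ι ι 𝕜} (hA : A.IsHermitian)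
    {x : ι → 𝕜} (hx : ∑ i, ‖x i‖ ^ 2 = 1) :
    smallestEigenvalue hA ≤ RCLike.re (star x ⬝ᵥ A *ᵥ x) := by
  rw [re_star_dotProduct_mulVec hA]
  calc smallestEigenvalue hA
      = ∑ i, smallestEigenvalue hA * ‖((star hA.eigenvectorUnitary).1 *ᵥ x) i‖ ^ 2 := by
        rw [← Finset.mul_sum, sum_norm_sq_unitary_mulVec, hx, mul_one]
    _ ≤ _ := by
        refine Finset.sum_le_sum fun i _ => mul_le_mul_of_nonneg_right ?_ (by positivity)
        exact Finset.inf'_le hA.eigenvalues (Finset.mem_univ i)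

theorem eigenvalues_le_largestEigenvalue_add {A B : Matrix ι ι 𝕜} (hA : A.IsHermitian)
    (hAB : (A + B).IsHermitian) {θ : ℝ} (hθ : 0 ≤ θ) {v : ι → 𝕜}
    (hB : B = (θ : 𝕜) • vecMulVec v (star v)) (i : ι) :
    hA.eigenvalues i ≤ largestEigenvalue hAB := by
  obtain ⟨x, hx, c, hc, h⟩ := exists_quadratic_form_perturbed hA hB i
  have := re_star_dotProduct_mulVec_le hAB hx
  nlinarith [mul_nonneg hθ hc]

theorem smallestEigenvalue_add_le_eigenvalues {A B : Matrix ι ι 𝕜} (hA : A.IsHermitian)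
    (hAB : (A + B).IsHermitian) {θ : ℝ} (hθ : θ ≤ 0) {v : ι → 𝕜}
    (hB : B = (θ : 𝕜) • vecMulVec v (star v)) (i : ι) :
    smallestEigenvalue hAB ≤ hA.eigenvalues i := by
  obtain ⟨x, hx, c, hc, h⟩ := exists_quadratic_form_perturbed hA hB i
  have := smallestEigenvalue_le_re_star_dotProduct_mulVec hAB hx
  nlinarith [mul_nonneg (neg_nonneg.2 hθ) hc]

end rankOne

/-! ### Deterministic limits: moment matching and decay of the overlap. -/

section analysis

/-- Moment matching on a fixed compact interval gives matching of all continuous functions. -/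
theorem tendsto_sum_continuous_of_moments {ι : ℕ → Type*} [∀ n, Fintype (ι n)]
    {l w c : ∀ n, ι n → ℝ} (hw : ∀ n i, 0 ≤ w n i) (hw1 : ∀ n, ∑ i, w n i = 1)
    (hc : ∀ n i, 0 ≤ c n i) (hc1 : ∀ n, ∑ i, c n i = 1) {K : ℝ}
    (hK : ∀ᶠ n in atTop, ∀ i, |l n i| ≤ K)
    (hmom : ∀ k : ℕ, Tendsto (fun n => ∑ i, w n i * l n i ^ k - ∑ i, c n i * l n i ^ k) atTop (𝓝 0))
    {f : ℝ → ℝ} (hf : Continuous f) :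
    Tendsto (fun n => ∑ i, w n i * f (l n i) - ∑ i, c n i * f (l n i)) atTop (𝓝 0) := by
  have hpoly : ∀ p : Polynomial ℝ, Tendsto
      (fun n => ∑ i, w n i * p.eval (l n i) - ∑ i, c n i * p.eval (l n i)) atTop (𝓝 0) := by
    intro p
    have h := tendsto_finsetSum p.support fun k _ => (hmom k).const_mul (p.coeff k)
    simp only [mul_zero, Finset.sum_const_zero] at h
    refine h.congr fun n => ?_
    simp only [Polynomial.eval_eq_sum, Polynomial.sum, Finset.mul_sum, mul_sub,
      Finset.sum_sub_distrib]
    congr 1 <;> rw [Finset.sum_comm] <;>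
      exact Finset.sum_congr rfl fun _ _ => Finset.sum_congr rfl fun _ _ => by ring
  rw [Metric.tendsto_atTop]
  intro ε hε
  -- Weierstrass approximation on `[-K, K]`, which eventually contains all the nodes; three errors
  -- of `ε / 4` are spent.
  obtain ⟨p, hp⟩ := exists_polynomial_near_of_continuousOn (-K) K f hf.continuousOn (ε / 4)
    (by positivity)
  have h1 := (Metric.tendsto_nhds.1 (hpoly p)) (ε / 4) (by positivity)
  obtain ⟨N, hN⟩ := eventually_atTop.1 (h1.and hK)
  refine ⟨N, fun n hn => ?_⟩
  obtain ⟨h2, h3⟩ := hN n hn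
  have happ : ∀ a : ι n → ℝ, (∀ i, 0 ≤ a i) → ∑ i, a i = 1 →
      |∑ i, a i * p.eval (l n i) - ∑ i, a i * f (l n i)| ≤ ε / 4 := by
    intro a ha ha1
    rw [← Finset.sum_sub_distrib]
    calc _ ≤ ∑ i, |a i * p.eval (l n i) - a i * f (l n i)| := Finset.abs_sum_le_sum_abs _ _
      _ ≤ ∑ i, a i * (ε / 4) := by
          refine Finset.sum_le_sum fun i _ => ?_
          rw [← mul_sub, abs_mul, abs_of_nonneg (ha i)]
          exact mul_le_mul_of_nonneg_left (hp _ (abs_le.1 (h3 i))).le (ha i)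
      _ = ε / 4 := by rw [← Finset.sum_mul, ha1, one_mul]
  have a1 := abs_le.1 (happ (w n) (hw n) (hw1 n))
  have a2 := abs_le.1 (happ (c n) (hc n) (hc1 n))
  rw [Real.dist_eq, sub_zero] at h2 ⊢
  have a3 := abs_lt.1 h2
  rw [abs_lt]
  constructor <;> linarith

/-- Deterministic core of the phase transition: overlap of the leading eigenvector of a rank-one
perturbation, in spectral coordinates. -/
theorem tendsto_overlap_zero {ι : ℕ → Type*} [∀ n, Fintype (ι n)]
    {l p q : ∀ n, ι n → ℝ} {t L : ℕ → ℝ} {θ b : ℝ} (hθ : 0 < θ)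
    (ht : ∀ n, 0 ≤ t n) (hq1 : ∀ n, ∑ i, q n i ^ 2 = 1)
    (heq : ∀ n i, θ * t n * p n i = (L n - l n i) * q n i)
    (hL : ∀ n i, l n i ≤ L n) (htp : ∀ n, t n ≤ ∑ i, p n i * q n i)
    (hb : ∀ z, b < z → ∀ᶠ n in atTop, ∀ i, l n i < z) {g₁ g₂ : ℝ → ℝ}
    (hg₁ : ∀ z, b < z → Tendsto (fun n => ∑ i, p n i ^ 2 * (1 / (z - l n i))) atTop (𝓝 (g₁ z)))
    (hg₂ : ∀ z, b < z →
      Tendsto (fun n => ∑ i, p n i ^ 2 * (1 / (z - l n i) ^ 2)) atTop (𝓝 (g₂ z)))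
    (hlt : ∀ z, b < z → θ * g₁ z < 1) (htop : Tendsto g₂ (𝓝[>] b) atTop) :
    Tendsto t atTop (𝓝 0) := by
  -- If `L n ≥ z`, solving for `q` gives `t ≤ ∑ p q ≤ t * θ * ∑ p ^ 2 / (z - l)`, whose last factors
  -- have product below one in the limit; here `t > 0`, since `t = 0` would force `q = 0`.
  have hLz : ∀ z, b < z → ∀ᶠ n in atTop, L n < z := by
    intro z hz
    filter_upwards [hb z hz, ((hg₁ z hz).const_mul θ).eventually_lt_const (hlt z hz)] with n h1 h2
    by_contra! hLn
    have hpos : ∀ i, 0 < L n - l n i := fun i => by linarith [h1 i]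
    have hq : ∀ i, q n i = θ * t n * p n i / (L n - l n i) := fun i => by
      rw [heq, mul_div_cancel_left₀ _ (hpos i).ne']
    have ht0 : 0 < t n := by
      rcases (ht n).eq_or_lt with h0 | h0
      · have := hq1 n
        simp [hq, ← h0] at this
      · exact h0
    have : t n ≤ t n * (θ * ∑ i, p n i ^ 2 * (1 / (z - l n i))) := by
      refine (htp n).trans ?_
      rw [Finset.mul_sum, Finset.mul_sum]
      refine Finset.sum_le_sum fun i _ => ?_
      have h3 : 1 / (L n - l n i) ≤ 1 / (z - l n i) :=
        one_div_le_one_div_of_le (by linarith [h1 i]) (by linarith)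
      calc p n i * q n i = (t n * θ * p n i ^ 2) * (1 / (L n - l n i)) := by rw [hq]; ring
        _ ≤ (t n * θ * p n i ^ 2) * (1 / (z - l n i)) := by gcongr
        _ = _ := by ring
    nlinarith
  rw [Metric.tendsto_nhds]
  intro ε hε
  obtain ⟨z, hz, hbz⟩ : ∃ z, 1 / (θ ^ 2 * ε ^ 2) < g₂ z ∧ b < z :=
    ((htop.eventually_gt_atTop _).and self_mem_nhdsWithin).exists
  filter_upwards [hLz z hbz, (hg₂ z hbz).eventually_const_lt hz] with n h1 h2
  rw [Real.dist_eq, sub_zero, abs_of_nonneg (ht n)]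
  by_contra! hεt
  -- Dividing by `z - l` rather than `L - l` avoids the possible zero of the latter, and `L < z`
  -- gives the right direction.
  have hle : θ ^ 2 * t n ^ 2 * ∑ i, p n i ^ 2 * (1 / (z - l n i) ^ 2) ≤ 1 := by
    refine le_of_le_of_eq ?_ (hq1 n)
    rw [Finset.mul_sum]
    refine Finset.sum_le_sum fun i _ => ?_
    have hzl : 0 < z - l n i := by linarith [hL n i]
    calc θ ^ 2 * t n ^ 2 * (p n i ^ 2 * (1 / (z - l n i) ^ 2))
        = (θ * t n * p n i) ^ 2 / (z - l n i) ^ 2 := by ring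
      _ = (L n - l n i) ^ 2 * q n i ^ 2 / (z - l n i) ^ 2 := by rw [heq, mul_pow]
      _ ≤ q n i ^ 2 := by
          rw [div_le_iff₀ (by positivity), mul_comm]
          have : (L n - l n i) ^ 2 ≤ (z - l n i) ^ 2 :=
            pow_le_pow_left₀ (sub_nonneg.2 (hL n i)) (by linarith) 2
          gcongr
  have h3 : 1 < θ ^ 2 * ε ^ 2 * ∑ i, p n i ^ 2 * (1 / (z - l n i) ^ 2) := by
    rw [div_lt_iff₀ (by positivity)] at h2
    linarith
  have h4 : 0 ≤ ∑ i, p n i ^ 2 * (1 / (z - l n i) ^ 2) :=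
    Finset.sum_nonneg fun i _ => by positivity
  have h5 : θ ^ 2 * ε ^ 2 * ∑ i, p n i ^ 2 * (1 / (z - l n i) ^ 2) ≤
      θ ^ 2 * t n ^ 2 * ∑ i, p n i ^ 2 * (1 / (z - l n i) ^ 2) := by gcongr
  linarith

/-! ### The Cauchy transform to the right of the support. -/

section cauchy
variable {ν : Measure ℝ} [IsProbabilityMeasure ν] {b : ℝ}

theorem integrable_one_div_sub_mul (hν : ∀ᵐ t ∂ν, t ≤ b) {y z : ℝ} (hy : b < y) (hz : b < z) :
    Integrable (fun t => 1 / (y - t) * (1 / (z - t))) ν := by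
  refine Integrable.of_bound (C := 1 / (y - b) * (1 / (z - b)))
    (by exact (by fun_prop : Measurable fun t : ℝ => 1 / (y - t) * (1 / (z - t))).aestronglyMeasurable) ?_
  filter_upwards [hν] with t ht
  have h1 : 0 < y - t := by linarith
  have h2 : 0 < z - t := by linarith
  have h3 : 0 < y - b := by linarith
  have h4 : 0 < z - b := by linarith
  rw [Real.norm_of_nonneg (by positivity)]
  gcongr

theorem integrable_one_div_sub (hν : ∀ᵐ t ∂ν, t ≤ b) {z : ℝ} (hz : b < z) :
    Integrable (fun t => 1 / (z - t)) ν := by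
  refine Integrable.of_bound (C := 1 / (z - b))
    (by exact (by fun_prop : Measurable fun t : ℝ => 1 / (z - t)).aestronglyMeasurable) ?_
  filter_upwards [hν] with t ht
  have h2 : 0 < z - t := by linarith
  have h4 : 0 < z - b := by linarith
  rw [Real.norm_of_nonneg (by positivity)]
  gcongr

theorem cauchyTransform_sub (hν : ∀ᵐ t ∂ν, t ≤ b) {y z : ℝ} (hy : b < y) (hz : b < z) :
    cauchyTransform ν y - cauchyTransform ν z =
      (z - y) * ∫ t, 1 / (y - t) * (1 / (z - t)) ∂ν := by
  unfold cauchyTransform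
  rw [← integral_sub (integrable_one_div_sub hν hy) (integrable_one_div_sub hν hz),
    ← integral_const_mul]
  refine integral_congr_ae ?_
  filter_upwards [hν] with t ht
  have h1 : y - t ≠ 0 := by linarith
  have h2 : z - t ≠ 0 := by linarith
  field_simp
  ring

theorem cauchyTransform_strictAntiOn (hν : ∀ᵐ t ∂ν, t ≤ b) :
    StrictAntiOn (cauchyTransform ν) (Set.Ioi b) := by
  intro y hy z hz hyz
  have h := cauchyTransform_sub hν hy hz
  have hpos : 0 < ∫ t, 1 / (y - t) * (1 / (z - t)) ∂ν := by
    have hp : ∀ᵐ t ∂ν, 0 < 1 / (y - t) * (1 / (z - t)) := by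
      filter_upwards [hν] with t ht
      have h1 : 0 < y - t := by linarith [Set.mem_Ioi.1 hy]
      have h2 : 0 < z - t := by linarith [Set.mem_Ioi.1 hz]
      positivity
    rw [integral_pos_iff_support_of_nonneg_ae (hp.mono fun _ h => h.le)
      (integrable_one_div_sub_mul hν hy hz)]
    refine pos_iff_ne_zero.2 fun h0 => ?_
    obtain ⟨t, ht, ht'⟩ := (hp.and (measure_eq_zero_iff_ae_notMem.1 h0)).exists
    exact ht' ht.ne'
  have : 0 < z - y := by linarith
  nlinarith

/-- Strict monotonicity, used at the midpoint of `b` and `z`, turns the weak bound on the edge limit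
into a strict one at `z`. -/
theorem cauchyTransform_lt_of_tendsto (hν : ∀ᵐ t ∂ν, t ≤ b) {g : EReal} {x : ℝ}
    (hg : Tendsto (fun z : ℝ => (cauchyTransform ν z : EReal)) (𝓝[>] b) (𝓝 g))
    (hgx : g ≤ (x : EReal)) {z : ℝ} (hz : b < z) : cauchyTransform ν z < x := by
  have hmid : b < (b + z) / 2 := by linarith
  have h1 : cauchyTransform ν z < cauchyTransform ν ((b + z) / 2) :=
    cauchyTransform_strictAntiOn hν hmid hz (by linarith)
  have h2 : ((cauchyTransform ν ((b + z) / 2) : ℝ) : EReal) ≤ g := by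
    refine ge_of_tendsto hg ?_
    filter_upwards [Ioo_mem_nhdsGT hmid] with y hy
    exact EReal.coe_le_coe_iff.2 (cauchyTransform_strictAntiOn hν hy.1 hmid hy.2).le
  exact h1.trans_le (EReal.coe_le_coe_iff.1 (h2.trans hgx))

/-- By the resolvent identity each slope towards a point `y > z` is minus the integral of `1 / ((z -
t) (y - t))`, which is dominated at `y = z`. This one inequality suffices and avoids differentiating
under the integral. -/
theorem neg_deriv_cauchyTransform_le (hν : ∀ᵐ t ∂ν, t ≤ b) {z : ℝ} (hz : b < z) :
    -deriv (cauchyTransform ν) z ≤ ∫ t, 1 / (z - t) ^ 2 ∂ν := by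
  by_cases hd : DifferentiableAt ℝ (cauchyTransform ν) z
  · have hsub : Set.Ioi z ⊆ {z}ᶜ := fun y hy => (Set.mem_Ioi.1 hy).ne'
    have h := (hasDerivAt_iff_tendsto_slope.1 hd.hasDerivAt).mono_left (nhdsWithin_mono z hsub)
    refine le_of_tendsto h.neg ?_
    filter_upwards [self_mem_nhdsWithin] with y hy
    have hy' : z < y := hy
    have hby : b < y := hz.trans hy'
    have hs : -slope (cauchyTransform ν) z y = ∫ t, 1 / (z - t) * (1 / (y - t)) ∂ν := by
      rw [slope_def_field, ← neg_div, neg_sub, cauchyTransform_sub hν hz hby,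
        mul_div_cancel_left₀ _ (by linarith)]
    rw [hs]
    refine integral_mono_ae (integrable_one_div_sub_mul hν hz hby)
      ((integrable_one_div_sub_mul hν hz hz).congr (Eventually.of_forall fun t => by
        simp only; rw [← _root_.one_div_pow, sq])) ?_
    filter_upwards [hν] with t ht
    have h1 : 0 < z - t := by linarith
    rw [← _root_.one_div_pow, sq]
    gcongr
  -- At a point of non-differentiability `deriv` takes the default value `0`.
  · rw [deriv_zero_of_not_differentiableAt hd, neg_zero]
    exact integral_nonneg fun t => by positivity

theorem tendsto_integral_one_div_sq_atTop (hν : ∀ᵐ t ∂ν, t ≤ b)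
    (h : Tendsto (deriv (cauchyTransform ν)) (𝓝[>] b) atBot) :
    Tendsto (fun z => ∫ t, 1 / (z - t) ^ 2 ∂ν) (𝓝[>] b) atTop := by
  refine tendsto_atTop_mono' _ ?_ (tendsto_neg_atBot_atTop.comp h)
  filter_upwards [self_mem_nhdsWithin] with z hz
  exact neg_deriv_cauchyTransform_le hν hz

end cauchy
end analysis

/-! ### Weak convergence up to the edge, and reflection. -/

section edge

theorem tendsto_sum_one_div_sub_pow {ι : ℕ → Type*} [∀ n, Fintype (ι n)]
    {ν : Measure ℝ} {b : ℝ} (hν : ∀ᵐ t ∂ν, t ≤ b) {l w : ∀ n, ι n → ℝ}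
    (hb : ∀ z, b < z → ∀ᶠ n in atTop, ∀ i, l n i < z)
    (hconv : ∀ f : BoundedContinuousFunction ℝ ℝ,
      Tendsto (fun n => ∑ i, w n i * f (l n i)) atTop (𝓝 (∫ t, f t ∂ν)))
    {z : ℝ} (hz : b < z) (m : ℕ) :
    Tendsto (fun n => ∑ i, w n i * (1 / (z - l n i) ^ m)) atTop (𝓝 (∫ t, 1 / (z - t) ^ m ∂ν)) := by
  have hδ : 0 < (z - b) / 2 := by linarith
  have hmax : ∀ t, 0 < max (z - t) ((z - b) / 2) := fun t => lt_max_of_lt_right hδ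
  -- Bounding the denominator below by `(z - b) / 2` gives a bounded continuous function that agrees
  -- with the singular one for `t ≤ (b + z) / 2`, where eventually all the nodes lie.
  let f : BoundedContinuousFunction ℝ ℝ := BoundedContinuousFunction.ofNormedAddCommGroup
    (fun t => 1 / max (z - t) ((z - b) / 2) ^ m)
    (continuous_const.div (by fun_prop) fun t => (pow_pos (hmax t) m).ne')
    (1 / ((z - b) / 2) ^ m) (fun t => by
      have := hmax t
      rw [Real.norm_of_nonneg (by positivity)]
      gcongr
      exact le_max_right _ _)
  have hf : ∀ t, t ≤ (b + z) / 2 → f t = 1 / (z - t) ^ m := fun t ht => by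
    change 1 / max (z - t) ((z - b) / 2) ^ m = _
    rw [max_eq_left (by linarith)]
  have hint : ∫ t, f t ∂ν = ∫ t, 1 / (z - t) ^ m ∂ν :=
    integral_congr_ae (hν.mono fun t ht => hf t (by linarith))
  rw [← hint]
  refine (hconv f).congr' ?_
  filter_upwards [hb ((b + z) / 2) (by linarith)] with n hn
  exact Finset.sum_congr rfl fun i _ => by rw [hf _ (hn i).le]

/-- Delocalization at the upper edge, in spectral coordinates. -/
theorem tendsto_overlap_zero_of_upper_edge {ι : ℕ → Type*} [∀ n, Fintype (ι n)]
    {ν : Measure ℝ} [IsProbabilityMeasure ν] {b : ℝ} (hν : ∀ᵐ t ∂ν, t ≤ b)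
    {l p q c : ∀ n, ι n → ℝ} {t L : ℕ → ℝ} {θ : ℝ} (hθ : 0 < θ)
    (hp1 : ∀ n, ∑ i, p n i ^ 2 = 1)
    (hc : ∀ n i, 0 ≤ c n i) (hc1 : ∀ n, ∑ i, c n i = 1)
    (ht : ∀ n, 0 ≤ t n) (hq1 : ∀ n, ∑ i, q n i ^ 2 = 1)
    (heq : ∀ n i, θ * t n * p n i = (L n - l n i) * q n i)
    (hL : ∀ n i, l n i ≤ L n) (htp : ∀ n, t n ≤ ∑ i, p n i * q n i)
    {K : ℝ} (hK : ∀ᶠ n in atTop, ∀ i, |l n i| ≤ K)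
    (hb : ∀ z, b < z → ∀ᶠ n in atTop, ∀ i, l n i < z)
    (hmom : ∀ k : ℕ, Tendsto (fun n => ∑ i, p n i ^ 2 * l n i ^ k - ∑ i, c n i * l n i ^ k)
      atTop (𝓝 0))
    (hweak : ∀ f : BoundedContinuousFunction ℝ ℝ,
      Tendsto (fun n => ∑ i, c n i * f (l n i)) atTop (𝓝 (∫ t, f t ∂ν)))
    {g : EReal} (hg : Tendsto (fun z : ℝ => (cauchyTransform ν z : EReal)) (𝓝[>] b) (𝓝 g))
    (hgθ : g ≤ ((1 / θ : ℝ) : EReal))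
    (hslope : Tendsto (deriv (cauchyTransform ν)) (𝓝[>] b) atBot) :
    Tendsto t atTop (𝓝 0) := by
  have hconv : ∀ f : BoundedContinuousFunction ℝ ℝ,
      Tendsto (fun n => ∑ i, p n i ^ 2 * f (l n i)) atTop (𝓝 (∫ t, f t ∂ν)) := by
    intro f
    have h := (tendsto_sum_continuous_of_moments (w := fun n i => p n i ^ 2)
      (fun n i => sq_nonneg _) hp1 hc hc1 hK hmom f.continuous).add (hweak f)
    simpa using h
  have hpow := fun z (hz : b < z) => tendsto_sum_one_div_sub_pow hν hb hconv hz
  refine tendsto_overlap_zero hθ ht hq1 heq hL htp hb (g₁ := cauchyTransform ν)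
    (fun z hz => by simpa [cauchyTransform] using hpow z hz 1) (fun z hz => hpow z hz 2)
    (fun z hz => ?_) (tendsto_integral_one_div_sq_atTop hν hslope)
  have := cauchyTransform_lt_of_tendsto hν hg hgθ hz
  rwa [lt_div_iff₀ hθ, mul_comm] at this

theorem cauchyTransform_map_neg (μ : Measure ℝ) (z : ℝ) :
    cauchyTransform (μ.map Neg.neg) z = -cauchyTransform μ (-z) := by
  unfold cauchyTransform
  have hm : MeasurableEmbedding (Neg.neg : ℝ → ℝ) := (Homeomorph.neg ℝ).measurableEmbedding
  rw [hm.integral_map, ← integral_neg]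
  refine integral_congr_ae (Eventually.of_forall fun t => ?_)
  change 1 / (z - -t) = -(1 / (-z - t))
  rw [← one_div_neg_eq_neg_one_div]
  congr 1
  ring

theorem integral_empiricalSpectralMeasure {𝕜 : Type*} [RCLike 𝕜] {ι : Type*} [Fintype ι]
    [DecidableEq ι] [Nonempty ι] {A : Matrix ι ι 𝕜} (hA : A.IsHermitian)
    (f : BoundedContinuousFunction ℝ ℝ) :
    ∫ t, f t ∂(empiricalSpectralMeasure hA : Measure ℝ) =
      ∑ i, (Fintype.card ι : ℝ)⁻¹ * f (hA.eigenvalues i) := by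
  change ∫ t, f t ∂((Fintype.card ι : ENNReal)⁻¹ • ∑ i, Measure.dirac (hA.eigenvalues i)) = _
  rw [integral_smul_measure, integral_finsetSum_measure fun i _ => integrable_dirac (by simp)]
  simp [Finset.mul_sum]

end edge

/-- Once the eigenvalues lie in `[-K, K]`, the normalizing denominator is at most `1 + K ^ k` and
can be removed. -/
theorem tendsto_moment_sub_of_momentGap {𝕜 : Type*} [RCLike 𝕜]
    {A : ∀ n : ℕ, Matrix (Fin (n + 1)) (Fin (n + 1)) 𝕜} (hA : ∀ n, (A n).IsHermitian)
    {θ : ℝ} (hθ : θ ≠ 0) {v : ∀ n : ℕ, Fin (n + 1) → 𝕜} {K : ℝ} (hK0 : 0 ≤ K)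
    (hK : ∀ᶠ n in atTop, ∀ i, |(hA n).eigenvalues i| ≤ K) (k : ℕ)
    (h : Tendsto (fun n => momentGap θ k (A n) ((θ : 𝕜) • vecMulVec (v n) (star (v n)))) atTop (𝓝 0)) :
    Tendsto (fun n => ∑ i, ‖(star (hA n).eigenvectorUnitary.1 *ᵥ v n) i‖ ^ 2 *
      (hA n).eigenvalues i ^ k - ∑ i, ((n : ℝ) + 1)⁻¹ * (hA n).eigenvalues i ^ k) atTop (𝓝 0) := by
  have h2 := (h.abs.mul_const (1 + K ^ k))
  rw [abs_zero, zero_mul] at h2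
  refine squeeze_zero_norm' ?_ h2
  filter_upwards [hK] with n hn
  have hpos : 0 < 1 + l2Norm (A n) ^ k := by
    have := pow_nonneg (l2Norm_nonneg (A n)) k
    positivity
  have hle : l2Norm (A n) ^ k ≤ K ^ k :=
    pow_le_pow_left₀ (l2Norm_nonneg _) (l2Norm_le_of_abs_eigenvalues_le (hA n) hK0 hn) k
  have e : ∑ i, ‖(star (hA n).eigenvectorUnitary.1 *ᵥ v n) i‖ ^ 2 *
      (hA n).eigenvalues i ^ k - ∑ i, ((n : ℝ) + 1)⁻¹ * (hA n).eigenvalues i ^ k =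
      momentGap θ k (A n) ((θ : 𝕜) • vecMulVec (v n) (star (v n))) * (1 + l2Norm (A n) ^ k) := by
    rw [momentGap_smul_vecMulVec hθ k (hA n), div_mul_cancel₀ _ hpos.ne', ← Finset.mul_sum]
    congr 1
    · exact Finset.sum_congr rfl fun i _ => mul_comm _ _
    · rw [Fintype.card_fin, inv_mul_eq_div]
      push_cast
      rfl
  rw [e, norm_mul, Real.norm_eq_abs, Real.norm_of_nonneg hpos.le]
  gcongr

end SpikedModel

end

/-! ### Assembly of the main theorem. -/

open SpikedModel Matrix in
/-- `X n` and `P n` are the matrices of size `n + 1`, so that all sizes `1, 2, 3, …` occur.  `𝕜` is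
`ℝ` (symmetric matrices, orthogonal group) or `ℂ` (Hermitian matrices, unitary group).  `Ga` and
`Gb` are the one-sided limits of the Cauchy transform at the edges, which always exist in
`[-∞, ∞]` by monotonicity. -/
theorem theorem2p3 {𝕜 : Type*} [RCLike 𝕜]
    {Ω : Type*} [MeasurableSpace Ω] (Pr : Measure Ω) [IsProbabilityMeasure Pr]
    (X P : ∀ n : ℕ, Ω → Matrix (Fin (n + 1)) (Fin (n + 1)) 𝕜)
    (hXmeas : ∀ n, Measurable (X n)) (hPmeas : ∀ n, Measurable (P n))
    (hX : ∀ n ω, (X n ω).IsHermitian) (hP : ∀ n ω, (P n ω).IsHermitian)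
    -- the limiting eigenvalue distribution and its edges
    (μ : ProbabilityMeasure ℝ) (hμ : IsCompact (μ : Measure ℝ).support)
    (a b : ℝ) (ha : IsGLB (μ : Measure ℝ).support a) (hb : IsLUB (μ : Measure ℝ).support b)
    (hesd : ∀ᵐ ω ∂Pr, Tendsto (fun n => SpikedModel.empiricalSpectralMeasure (hX n ω)) atTop (𝓝 μ))
    (hmin : ∀ᵐ ω ∂Pr, Tendsto (fun n => SpikedModel.smallestEigenvalue (hX n ω)) atTop (𝓝 a))
    (hmax : ∀ᵐ ω ∂Pr, Tendsto (fun n => SpikedModel.largestEigenvalue (hX n ω)) atTop (𝓝 b))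
    -- the perturbation has rank one, with sole non-zero eigenvalue `θ`
    (θ : ℝ) (hθ : θ ≠ 0)
    (hrank : ∀ n ω, (P n ω).rank = 1)
    (heig : ∀ n ω, Module.End.HasEigenvalue (Matrix.toLin' (P n ω)) (θ : 𝕜))
    (hindep : ∀ n, IndepFun (X n) (P n) Pr)
    (hinv : ∀ n, SpikedModel.IsConjInvariant Pr (X n) ∨ SpikedModel.IsConjInvariant Pr (P n))
    -- the subcritical condition and the infinite slope at the relevant edge
    (Ga Gb : EReal)
    (hGa : Tendsto (fun z : ℝ => (SpikedModel.cauchyTransform μ z : EReal)) (𝓝[<] a) (𝓝 Ga))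
    (hGb : Tendsto (fun z : ℝ => (SpikedModel.cauchyTransform μ z : EReal)) (𝓝[>] b) (𝓝 Gb))
    (hsub : ((1 / θ : ℝ) : EReal) ∉ Set.Ioo Ga Gb)
    (hslope_pos : 0 < θ → Tendsto (deriv (SpikedModel.cauchyTransform μ)) (𝓝[>] b) atBot)
    (hslope_neg : θ < 0 → Tendsto (deriv (SpikedModel.cauchyTransform μ)) (𝓝[<] a) atBot)
    -- a unit eigenvector of `X + P` for its largest or smallest eigenvalue
    (u : ∀ n : ℕ, Ω → EuclideanSpace 𝕜 (Fin (n + 1)))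
    (hu_pos : 0 < θ → ∀ n ω, SpikedModel.IsUnitEigenvector (X n ω + P n ω)
      (SpikedModel.largestEigenvalue ((hX n ω).add (hP n ω))) (u n ω))
    (hu_neg : θ < 0 → ∀ n ω, SpikedModel.IsUnitEigenvector (X n ω + P n ω)
      (SpikedModel.smallestEigenvalue ((hX n ω).add (hP n ω))) (u n ω)) :
    ∀ᵐ ω ∂Pr, Tendsto (fun n => SpikedModel.projNorm (u n ω) (SpikedModel.kerSub θ (P n ω)))
      atTop (𝓝 0) := by
  choose v hv1 hPv using fun n ω => exists_eq_smul_vecMulVec (hP n ω) (hrank n ω) hθ (heig n ω)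
  have hgap := ae_tendsto_momentGap hXmeas hPmeas hX hindep hinv hθ
    (fun n ω => ⟨v n ω, hv1 n ω, hPv n ω⟩)
  have hsupp : ∀ᵐ t ∂(μ : Measure ℝ), t ∈ (μ : Measure ℝ).support := Measure.support_mem_ae
  filter_upwards [hgap, hesd, hmin, hmax] with ω hgap hesd hmin hmax
  set A : ∀ n : ℕ, Matrix (Fin (n + 1)) (Fin (n + 1)) 𝕜 := fun n => X n ω with hAdef
  have hA : ∀ n, (A n).IsHermitian := fun n => hX n ω
  set l : ∀ n : ℕ, Fin (n + 1) → ℝ := fun n i => (hA n).eigenvalues i with hl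
  have hlmax : ∀ n i, l n i ≤ largestEigenvalue (hX n ω) := fun n i =>
    Finset.le_sup' (hA n).eigenvalues (Finset.mem_univ i)
  have hlmin : ∀ n i, smallestEigenvalue (hX n ω) ≤ l n i := fun n i =>
    Finset.inf'_le (hA n).eigenvalues (Finset.mem_univ i)
  have hub : ∀ z, b < z → ∀ᶠ n in atTop, ∀ i, l n i < z := fun z hz =>
    (hmax.eventually_lt_const hz).mono fun n hn i => (hlmax n i).trans_lt hn
  have hlb : ∀ z, z < a → ∀ᶠ n in atTop, ∀ i, z < l n i := fun z hz =>
    (hmin.eventually_const_lt hz).mono fun n hn i => hn.trans_le (hlmin n i)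
  have hK : ∀ᶠ n in atTop, ∀ i, |l n i| ≤ |a| + |b| + 1 := by
    filter_upwards [hub (b + 1) (by linarith), hlb (a - 1) (by linarith)] with n h1 h2 i
    rw [abs_le]
    constructor <;> linarith [h1 i, h2 i, neg_abs_le a, le_abs_self b, abs_nonneg a, abs_nonneg b]
  have hmom := fun k => tendsto_moment_sub_of_momentGap hA hθ (v := fun n => v n ω)
    (K := |a| + |b| + 1) (by positivity) hK k (by
      refine (hgap k).congr fun n => ?_
      rw [hPv n ω])
  have hweak : ∀ f : BoundedContinuousFunction ℝ ℝ,
      Tendsto (fun n : ℕ => ∑ i, ((n : ℝ) + 1)⁻¹ * f (l n i)) atTop (𝓝 (∫ x, f x ∂(μ : Measure ℝ))) := by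
    intro f
    refine (ProbabilityMeasure.tendsto_iff_forall_integral_tendsto.1 hesd f).congr fun n => ?_
    rw [integral_empiricalSpectralMeasure, Fintype.card_fin]
    push_cast
    rfl
  set V : ∀ n : ℕ, Matrix.unitaryGroup (Fin (n + 1)) 𝕜 := fun n => star (hA n).eigenvectorUnitary
  set p : ∀ n : ℕ, Fin (n + 1) → ℝ := fun n i => ‖((V n).1.mulVec (v n ω)) i‖ with hp
  set q : ∀ n : ℕ, Fin (n + 1) → ℝ := fun n i => ‖((V n).1.mulVec (u n ω).ofLp) i‖ with hq
  set t : ℕ → ℝ := fun n => ‖star (v n ω) ⬝ᵥ (u n ω).ofLp‖ with ht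
  have hp1 : ∀ n, ∑ i, p n i ^ 2 = 1 := fun n => by
    rw [hp, sum_norm_sq_unitary_mulVec, hv1]
  have hc : ∀ n : ℕ, Fin (n + 1) → 0 ≤ ((n : ℝ) + 1)⁻¹ := fun n i => by positivity
  have hc1 : ∀ n : ℕ, ∑ _i : Fin (n + 1), ((n : ℝ) + 1)⁻¹ = 1 := fun n => by
    rw [Finset.sum_const, Finset.card_univ, Fintype.card_fin, nsmul_eq_mul]
    push_cast
    exact mul_inv_cancel₀ (by positivity)
  have htp : ∀ n, t n ≤ ∑ i, p n i * q n i := fun n => norm_star_dotProduct_le (V n) _ _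
  have hq1 : ∀ n, ‖u n ω‖ = 1 → ∑ i, q n i ^ 2 = 1 := fun n h => by
    rw [hq, sum_norm_sq_unitary_mulVec, ← EuclideanSpace.norm_sq_eq, h, one_pow]
  have heq : ∀ (n : ℕ) (L : ℝ), IsUnitEigenvector (X n ω + P n ω) L (u n ω) →
      ∀ i, |θ| * t n * p n i = |L - l n i| * q n i := fun n L h i =>
    perturbed_eigenvector_coord (hA n) (by
      rw [← hPv n ω]
      exact congrArg WithLp.ofLp h.2) i
  suffices hmain : Tendsto t atTop (𝓝 0) by
    refine squeeze_zero (fun n => norm_nonneg _) (fun n => ?_) hmain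
    rw [hPv n ω]
    exact projNorm_kerSub_le hθ (hv1 n ω) _
  have hμb : ∀ᵐ x ∂(μ : Measure ℝ), x ≤ b := hsupp.mono fun x hx => hb.1 hx
  have hμa : ∀ᵐ x ∂(μ : Measure ℝ), a ≤ x := hsupp.mono fun x hx => ha.1 hx
  rcases hθ.lt_or_gt with hneg | hpos
  -- As `1 / θ < 0 ≤ Gb`, lying outside the open interval can only mean `1 / θ ≤ Ga`.
  · have hGb0 : (0 : EReal) ≤ Gb := by
      refine ge_of_tendsto hGb ?_
      filter_upwards [self_mem_nhdsWithin] with z hz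
      refine EReal.coe_nonneg.2 (integral_nonneg_of_ae ?_)
      filter_upwards [hμb] with x hx
      exact one_div_nonneg.2 (by linarith [Set.mem_Ioi.1 hz])
    have hGaθ : ((1 / θ : ℝ) : EReal) ≤ Ga := by
      by_contra! h
      exact hsub ⟨h, lt_of_lt_of_le (by exact_mod_cast one_div_neg.2 hneg) hGb0⟩
    have hneg_lim : Tendsto (fun z : ℝ => -z) (𝓝[>] (-a)) (𝓝[<] a) := by
      have := tendsto_neg_nhdsGT (a := -a)
      rwa [neg_neg] at this
    have hm : MeasurableEmbedding (Neg.neg : ℝ → ℝ) := (Homeomorph.neg ℝ).measurableEmbedding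
    have : IsProbabilityMeasure ((μ : Measure ℝ).map Neg.neg) :=
      Measure.isProbabilityMeasure_map hm.measurable.aemeasurable
    have hfun : cauchyTransform ((μ : Measure ℝ).map Neg.neg) = fun z => -cauchyTransform μ (-z) :=
      funext fun z => cauchyTransform_map_neg μ z
    -- Negating `X`, `P` and `μ` turns the lower edge `a` into the upper edge `-a` and leaves `p`,
    -- `q` and `t` unchanged.
    refine tendsto_overlap_zero_of_upper_edge (ν := (μ : Measure ℝ).map Neg.neg) (b := -a)
      (l := fun n i => -l n i) (p := p) (q := q) (c := fun n _ => ((n : ℝ) + 1)⁻¹) (t := t)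
      (L := fun n => -smallestEigenvalue ((hX n ω).add (hP n ω))) (θ := -θ) (g := -Ga)
      (K := |a| + |b| + 1) ?_ (by linarith) hp1 hc hc1 (fun n => norm_nonneg _)
      (fun n => hq1 n (hu_neg hneg n ω).1) ?_ ?_ htp ?_ ?_ ?_ ?_ ?_ ?_ ?_
    · rw [hm.ae_map_iff]
      exact hμa.mono fun x hx => neg_le_neg hx
    · intro n i
      have h := heq n _ (hu_neg hneg n ω) i
      have hle := smallestEigenvalue_add_le_eigenvalues (hA n) ((hX n ω).add (hP n ω)) hneg.le
        (hPv n ω) i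
      rw [abs_of_neg hneg, abs_of_nonpos (sub_nonpos.2 hle)] at h
      rw [h]
      ring
    · exact fun n i => neg_le_neg (smallestEigenvalue_add_le_eigenvalues (hA n)
        ((hX n ω).add (hP n ω)) hneg.le (hPv n ω) i)
    · simpa only [abs_neg] using hK
    · intro z hz
      filter_upwards [hlb (-z) (by linarith)] with n hn i
      linarith [hn i]
    · intro k
      have h := (hmom k).const_mul ((-1) ^ k)
      rw [mul_zero] at h
      refine h.congr fun n => ?_
      rw [mul_sub, Finset.mul_sum, Finset.mul_sum]
      congr 1 <;> refine Finset.sum_congr rfl fun i _ => ?_ <;> rw [neg_pow (l n i)]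
      · simp only [hp]; ring_nf; rfl
      · ring
    · intro f
      have h := hweak (f.compContinuous ⟨Neg.neg, continuous_neg⟩)
      rw [hm.integral_map]
      exact h
    · rw [hfun]
      have h := ((continuous_neg (G := EReal)).tendsto Ga).comp (hGa.comp hneg_lim)
      refine h.congr fun z => ?_
      simp
    · have : ((1 / -θ : ℝ) : EReal) = -((1 / θ : ℝ) : EReal) := by
        rw [← EReal.coe_neg, one_div_neg_eq_neg_one_div]
      rw [this]
      exact EReal.neg_le_neg_iff.2 hGaθ
    -- The reflected transform is `z ↦ -G(-z)`; the two signs cancel in the derivative, so the slope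
    -- at the edge is still `-∞`.
    · have hd : deriv (cauchyTransform ((μ : Measure ℝ).map Neg.neg)) =
          fun z => deriv (cauchyTransform μ) (-z) := by
        rw [hfun]
        funext z
        rw [deriv.fun_neg, deriv_comp_neg, neg_neg]
      rw [hd]
      exact (hslope_neg hneg).comp hneg_lim
  -- Here `Ga ≤ 0 < 1 / θ`, so lying outside the interval means `Gb ≤ 1 / θ`.
  · have hGa0 : Ga ≤ (0 : EReal) := by
      refine le_of_tendsto hGa ?_
      filter_upwards [self_mem_nhdsWithin] with z hz
      refine EReal.coe_nonpos.2 (integral_nonpos_of_ae ?_)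
      filter_upwards [hμa] with x hx
      exact one_div_nonpos.2 (by linarith [Set.mem_Iio.1 hz])
    have hGbθ : Gb ≤ ((1 / θ : ℝ) : EReal) := by
      by_contra! h
      exact hsub ⟨lt_of_le_of_lt hGa0 (by exact_mod_cast one_div_pos.2 hpos), h⟩
    refine tendsto_overlap_zero_of_upper_edge hμb (l := l) (p := p) (q := q)
      (c := fun n _ => ((n : ℝ) + 1)⁻¹) (t := t)
      (L := fun n => largestEigenvalue ((hX n ω).add (hP n ω))) hpos hp1 hc hc1
      (fun n => norm_nonneg _) (fun n => hq1 n (hu_pos hpos n ω).1) ?_ ?_ htp hK hub hmom hweak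
      hGb hGbθ (hslope_pos hpos)
    · intro n i
      have h := heq n _ (hu_pos hpos n ω) i
      have hle := eigenvalues_le_largestEigenvalue_add (hA n) ((hX n ω).add (hP n ω)) hpos.le
        (hPv n ω) i
      rwa [abs_of_pos hpos, abs_of_nonneg (sub_nonneg.2 hle)] at h
    · exact fun n i => eigenvalues_le_largestEigenvalue_add (hA n) ((hX n ω).add (hP n ω)) hpos.le
        (hPv n ω) i
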